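/- Theorem (maximal empty rectangle queries). The model of computation is the real RAM: integer and real registers, random-access arrays of integers and of reals, unit-cost integer arithmetic on words, and unit-cost exact field operations and comparisons on reals (no conversion of reals to integers); program constants are natural or rational numbers. Every stored integer must be smaller than the memory bound stated below. Let $A=[a_0,a_1]\times[b_0,b_1]$ with $a_0<a_1$ and $b_0<b_1$, and let $P\subset A$ be a set of $n$ points. An empty rectangle is a closed axis-parallel rectangle $R=[x_0,x_1]\times[y_0,y_1]\subseteq A$ with $x_0<x_1$, $y_0<y_1$ whose interior contains no point of $P$. There is a preprocessing algorithm that, given $A$ and the list of the points of $P$, builds a data structure in $O(n^2\log n)$ time and $O(n^2\log n)$ space, and there is a query algorithm that, given this data structure and the coordinates of any point $q\in A$, reports in $O(\log n)$ time an empty rectangle containing $q$ whose area is the largest among all empty rectangles containing $q$, and leaves the data structure unchanged. Precisely, there are two fixed programs and one constant $K$, independent of $n$, $A$, $P$ and $q$, such that for every $n\ge 0$ preprocessing takes at most $K(n^2\lfloor\log_2 n\rfloor+1)$ steps, each query takes at most $K(\lfloor\log_2 n\rfloor+1)$ steps, and both access only cells with index smaller than $K(n^2\lfloor\log_2 n\rfloor+1)$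 of a fixed finite number of arrays (with $\lfloor\log_2 0\rfloor$ read as $0$). -/

import Mathlib

/-! ## Axis-parallel rectangles and empty rectangles -/

/-- A (nondegenerate, closed) axis-parallel rectangle `[x₀, x₁] × [y₀, y₁]` in the plane. -/
structure Rect where
  x₀ : ℝ
  x₁ : ℝ
  y₀ : ℝ
  y₁ : ℝ
  hx : x₀ < x₁
  hy : y₀ < y₁

namespace Rect

/-- The closed region occupied by the rectangle. -/
def region (R : Rect) : Set (ℝ × ℝ) := Set.Icc R.x₀ R.x₁ ×ˢ Set.Icc R.y₀ R.y₁

/-- The area of the rectangle. -/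
def area (R : Rect) : ℝ := (R.x₁ - R.x₀) * (R.y₁ - R.y₀)

/-- `R` is an empty rectangle inside `A` for the obstacle set `P`: it lies inside `A`, and no
point of `P` lies in its interior (obstacles may touch the boundary, as they do for every
maximal empty rectangle that is bounded by an obstacle). -/
def IsEmptyIn (R A : Rect) (P : Set (ℝ × ℝ)) : Prop :=
  R.region ⊆ A.region ∧ Disjoint (interior R.region) P

/-- `R` has the largest area among all empty rectangles inside `A` that contain `q`. -/
def IsLargestEmptyAt (R A : Rect) (P : Set (ℝ × ℝ)) (q : ℝ × ℝ) : Prop :=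
  R.IsEmptyIn A P ∧ q ∈ R.region ∧
    ∀ R' : Rect, R'.IsEmptyIn A P → q ∈ R'.region → R'.area ≤ R.area

end Rect

/-! ## The real RAM

The machine has integer registers, real registers, and a memory made of integer arrays and real
arrays. A program is a finite text, so it names only finitely many registers and arrays, and its
only constants are natural and rational numbers. Integers support indexing and word arithmetic;
reals support the field operations and exact comparison (no rounding, no conversion to integers).
A run is made relative to a bound `S`, which limits both the memory and the word size: only cells
with index below `S` may be read or written, and only integers below `S` may be stored. -/

namespace RealRAM

/-- Memory contents: `ints a i` and `reals a i` are the cells with index `i` of the integer array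
and of the real array with name `a`. -/
structure Memory where
  ints : ℕ → ℕ → ℕ
  reals : ℕ → ℕ → ℝ

/-- A machine state: the integer registers, the real registers and the memory. -/
structure State where
  intReg : ℕ → ℕ
  realReg : ℕ → ℝ
  mem : Memory

/-- Integer-valued expressions; `sub` is truncated subtraction, `div` is integer division. -/
inductive IntExpr where
  | const (k : ℕ)
  | reg (x : ℕ)
  | load (a : ℕ) (i : IntExpr)
  | add (e f : IntExpr)
  | sub (e f : IntExpr)
  | mul (e f : IntExpr)
  | div (e f : IntExpr)

/-- Real-valued expressions. -/
inductive RealExpr where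
  | const (c : ℚ)
  | reg (x : ℕ)
  | load (a : ℕ) (i : IntExpr)
  | add (e f : RealExpr)
  | sub (e f : RealExpr)
  | mul (e f : RealExpr)
  | div (e f : RealExpr)

/-- Tests for branching and loops; `and` and `or` are evaluated from left to right and stop as
soon as the outcome is known. -/
inductive Test where
  | intLt (e f : IntExpr)
  | intEq (e f : IntExpr)
  | realLt (e f : RealExpr)
  | realEq (e f : RealExpr)
  | not (b : Test)
  | and (b c : Test)
  | or (b c : Test)

/-- Programs. -/
inductive Cmd where
  | skip
  | setInt (x : ℕ) (e : IntExpr)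
  | setReal (x : ℕ) (e : RealExpr)
  | storeInt (a : ℕ) (i e : IntExpr)
  | storeReal (a : ℕ) (i : IntExpr) (e : RealExpr)
  | seq (c d : Cmd)
  | ite (b : Test) (c d : Cmd)
  | while (b : Test) (c : Cmd)

/-! ### Values -/

/-- The value of an integer expression. -/
def IntExpr.eval (s : State) : IntExpr → ℕ
  | const k => k
  | reg x => s.intReg x
  | load a i => s.mem.ints a (i.eval s)
  | add e f => e.eval s + f.eval s
  | sub e f => e.eval s - f.eval s
  | mul e f => e.eval s * f.eval s
  | div e f => e.eval s / f.eval s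

/-- The value of a real expression. -/
noncomputable def RealExpr.eval (s : State) : RealExpr → ℝ
  | const c => (c : ℝ)
  | reg x => s.realReg x
  | load a i => s.mem.reals a (i.eval s)
  | add e f => e.eval s + f.eval s
  | sub e f => e.eval s - f.eval s
  | mul e f => e.eval s * f.eval s
  | div e f => e.eval s / f.eval s

/-- The outcome of a test. -/
def Test.Holds (s : State) : Test → Prop
  | intLt e f => e.eval s < f.eval s
  | intEq e f => e.eval s = f.eval s
  | realLt e f => e.eval s < f.eval s
  | realEq e f => e.eval s = f.eval s
  | not b => ¬ b.Holds s
  | and b c => b.Holds s ∧ c.Holds s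
  | or b c => b.Holds s ∨ c.Holds s

/-! ### Legality: reads stay below the bound `S`, and divisors are nonzero -/

/-- The integer expression can be evaluated legally. -/
def IntExpr.Legal (S : ℕ) (s : State) : IntExpr → Prop
  | const _ => True
  | reg _ => True
  | load _ i => i.Legal S s ∧ i.eval s < S
  | add e f => e.Legal S s ∧ f.Legal S s
  | sub e f => e.Legal S s ∧ f.Legal S s
  | mul e f => e.Legal S s ∧ f.Legal S s
  | div e f => e.Legal S s ∧ f.Legal S s ∧ f.eval s ≠ 0

/-- The real expression can be evaluated legally. -/
def RealExpr.Legal (S : ℕ) (s : State) : RealExpr → Prop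
  | const _ => True
  | reg _ => True
  | load _ i => i.Legal S s ∧ i.eval s < S
  | add e f => e.Legal S s ∧ f.Legal S s
  | sub e f => e.Legal S s ∧ f.Legal S s
  | mul e f => e.Legal S s ∧ f.Legal S s
  | div e f => e.Legal S s ∧ f.Legal S s ∧ f.eval s ≠ 0

/-- The test can be evaluated legally. -/
def Test.Legal (S : ℕ) (s : State) : Test → Prop
  | intLt e f => e.Legal S s ∧ f.Legal S s
  | intEq e f => e.Legal S s ∧ f.Legal S s
  | realLt e f => e.Legal S s ∧ f.Legal S s
  | realEq e f => e.Legal S s ∧ f.Legal S s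
  | not b => b.Legal S s
  | and b c => b.Legal S s ∧ (b.Holds s → c.Legal S s)
  | or b c => b.Legal S s ∧ (¬ b.Holds s → c.Legal S s)

/-! ### Costs: one step for each constant, register access, load, operation and comparison -/

/-- The number of steps for evaluating an integer expression. -/
def IntExpr.cost : IntExpr → ℕ
  | const _ => 1
  | reg _ => 1
  | load _ i => i.cost + 1
  | add e f => e.cost + f.cost + 1
  | sub e f => e.cost + f.cost + 1
  | mul e f => e.cost + f.cost + 1
  | div e f => e.cost + f.cost + 1

/-- The number of steps for evaluating a real expression. -/
def RealExpr.cost : RealExpr → ℕ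
  | const _ => 1
  | reg _ => 1
  | load _ i => i.cost + 1
  | add e f => e.cost + f.cost + 1
  | sub e f => e.cost + f.cost + 1
  | mul e f => e.cost + f.cost + 1
  | div e f => e.cost + f.cost + 1

/-- The number of steps charged for evaluating a test. -/
def Test.cost : Test → ℕ
  | intLt e f => e.cost + f.cost + 1
  | intEq e f => e.cost + f.cost + 1
  | realLt e f => e.cost + f.cost + 1
  | realEq e f => e.cost + f.cost + 1
  | not b => b.cost + 1
  | and b c => b.cost + c.cost + 1
  | or b c => b.cost + c.cost + 1

/-! ### State updates and runs -/

/-- Write `v` to the integer register `x`. -/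
def State.setInt (s : State) (x v : ℕ) : State :=
  { s with intReg := Function.update s.intReg x v }

/-- Write `v` to the real register `x`. -/
noncomputable def State.setReal (s : State) (x : ℕ) (v : ℝ) : State :=
  { s with realReg := Function.update s.realReg x v }

/-- Write `v` to the cell `i` of the integer array `a`. -/
def State.storeInt (s : State) (a i v : ℕ) : State :=
  { s with mem :=
    { s.mem with ints := Function.update s.mem.ints a (Function.update (s.mem.ints a) i v) } }

/-- Write `v` to the cell `i` of the real array `a`. -/
noncomputable def State.storeReal (s : State) (a i : ℕ) (v : ℝ) : State :=
  { s with mem :=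
    { s.mem with reals := Function.update s.mem.reals a (Function.update (s.mem.reals a) i v) } }

/-- `Exec S c s s' t`: started in state `s`, the program `c` halts in state `s'` after exactly `t`
steps, all of them legal for the bound `S`: it reads and writes only memory cells with index
below `S`, stores only integers below `S`, and never divides by zero. -/
inductive Exec (S : ℕ) : Cmd → State → State → ℕ → Prop where
  | skip (s : State) : Exec S .skip s s 1
  | setInt (s : State) (x : ℕ) (e : IntExpr) (he : e.Legal S s) (hv : e.eval s < S) :
      Exec S (.setInt x e) s (s.setInt x (e.eval s)) (e.cost + 1)
  | setReal (s : State) (x : ℕ) (e : RealExpr) (he : e.Legal S s) :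
      Exec S (.setReal x e) s (s.setReal x (e.eval s)) (e.cost + 1)
  | storeInt (s : State) (a : ℕ) (i e : IntExpr) (hi : i.Legal S s) (hS : i.eval s < S)
      (he : e.Legal S s) (hv : e.eval s < S) :
      Exec S (.storeInt a i e) s (s.storeInt a (i.eval s) (e.eval s)) (i.cost + e.cost + 1)
  | storeReal (s : State) (a : ℕ) (i : IntExpr) (e : RealExpr) (hi : i.Legal S s)
      (hS : i.eval s < S) (he : e.Legal S s) :
      Exec S (.storeReal a i e) s (s.storeReal a (i.eval s) (e.eval s)) (i.cost + e.cost + 1)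
  | seq {c d : Cmd} {s s' s'' : State} {t t' : ℕ} (hc : Exec S c s s' t)
      (hd : Exec S d s' s'' t') : Exec S (.seq c d) s s'' (t + t')
  | iteTrue {b : Test} {c d : Cmd} {s s' : State} {t : ℕ} (hb : b.Legal S s) (h : b.Holds s)
      (hc : Exec S c s s' t) : Exec S (.ite b c d) s s' (b.cost + 1 + t)
  | iteFalse {b : Test} {c d : Cmd} {s s' : State} {t : ℕ} (hb : b.Legal S s) (h : ¬ b.Holds s)
      (hd : Exec S d s s' t) : Exec S (.ite b c d) s s' (b.cost + 1 + t)
  | whileTrue {b : Test} {c : Cmd} {s s' s'' : State} {t t' : ℕ} (hb : b.Legal S s)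
      (h : b.Holds s) (hc : Exec S c s s' t) (hw : Exec S (.while b c) s' s'' t') :
      Exec S (.while b c) s s'' (b.cost + 1 + t + t')
  | whileFalse {b : Test} {c : Cmd} {s : State} (hb : b.Legal S s) (h : ¬ b.Holds s) :
      Exec S (.while b c) s s (b.cost + 1)

end RealRAM

/-! ## Input and output conventions for the rectangle query problem -/

/-- The state in which preprocessing starts. Integer register 0 holds `n`; real registers 0 to 3
hold `x₀, x₁, y₀, y₁` of the rectangle `A`; cells `0, …, n - 1` of the real arrays 0 and 1 hold the
first and the second coordinates of the points. Everything else is zero. -/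
noncomputable def qmerInput {n : ℕ} (A : Rect) (p : Fin n → ℝ × ℝ) : RealRAM.State where
  intReg x := if x = 0 then n else 0
  realReg x :=
    if x = 0 then A.x₀ else if x = 1 then A.x₁ else if x = 2 then A.y₀ else
      if x = 3 then A.y₁ else 0
  mem :=
    { ints := fun _ _ => 0
      reals := fun a i =>
        if h : i < n then
          if a = 0 then (p ⟨i, h⟩).1 else if a = 1 then (p ⟨i, h⟩).2 else 0
        else 0 }

/-- The state in which a query starts: the memory holds the data structure `m`, real registers
0 and 1 hold the coordinates of the query point `q`, and all other registers are zero. -/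
noncomputable def qmerQuery (m : RealRAM.Memory) (q : ℝ × ℝ) : RealRAM.State where
  intReg _ := 0
  realReg x := if x = 0 then q.1 else if x = 1 then q.2 else 0
  mem := m

/-- The rectangle `R` is reported in state `s`: real registers 0 to 3 hold `x₀, x₁, y₀, y₁`. -/
def Reports (s : RealRAM.State) (R : Rect) : Prop :=
  s.realReg 0 = R.x₀ ∧ s.realReg 1 = R.x₁ ∧ s.realReg 2 = R.y₀ ∧ s.realReg 3 = R.y₁

/-! Quadratically many candidate rectangles suffice, and a table with O(n² log n) cells can hold the
best candidate for every possible position of a query point.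

Candidates. Two opposite corners of A join the points, which gives N = n + 2 grid points, sorted by
height. Let R be an empty rectangle. If a grid point lies at or below the height of the lower side
of R, with abscissa strictly between those of the vertical sides, the lower side can be pushed down
to the highest such point. Otherwise it can be pushed down to the lower side of A, and the left side
can be pushed left to a grid abscissa (`Grid.exists_anchor`). Either way the lower side now meets an
anchor: a grid point or its projection to the lower side of A. A sweep upwards from the anchor keeps
the widest window around it that avoids the points passed so far, and one of the N boxes of this
sweep contains the enlarged R (`Grid.exists_sweepBox`). Conversely, nondegenerate sweep boxes are
empty (`Grid.sweepBox_valid`). There are 2N anchors, hence at most 2N² boxes.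

Discretization. All sides of the boxes have grid coordinates, so the boxes containing q depend only
on where the coordinates of q lie among the sorted grid values (`gridPos_le_iff`). With M = 2N
positions per axis, a box becomes a product of two ranges of positions.

Table. A horizontal range splits into O(log N) nodes of a segment tree, and a vertical range is the
union of two overlapping ranges whose length is a power of two. Each box is therefore entered in
O(log N) cells (`insert_runs`), and a cell keeps the largest area. One pass from coarse to fine then
lets each cell take the maximum with three cells whose regions contain its own (`complete_runs`).
After that, the cell of a single pair of positions is at least as good as every box covering this
pair (`val_le_leaf`). A query is two binary searches and one lookup (`query_runs`).

On the machine, correctness and running time are proved together: `Runs` is a Hoare triple with a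
step bound, loops use invariants (`Runs.whileLoop`, `Runs.forLoop`), straight-line code uses `wp`,
and `Frame` carries over everything that a program cannot write. -/

namespace RealRAM

/-! ## Total correctness with time bounds -/

/-- Started in `s`, the program `c` halts within `T` steps in a state that satisfies `Q`. -/
def Runs (S : ℕ) (c : Cmd) (s : State) (T : ℕ) (Q : State → Prop) : Prop :=
  ∃ s' t, Exec S c s s' t ∧ t ≤ T ∧ Q s'

/-- The integer registers that a program may write. -/
def Cmd.writesInt : Cmd → ℕ → Bool
  | skip, _ => false
  | setInt x _, y => x == y
  | setReal _ _, _ => false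
  | storeInt _ _ _, _ => false
  | storeReal _ _ _, _ => false
  | seq c d, y => c.writesInt y || d.writesInt y
  | ite _ c d, y => c.writesInt y || d.writesInt y
  | .while _ c, y => c.writesInt y

/-- The real registers that a program may write. -/
def Cmd.writesReal : Cmd → ℕ → Bool
  | skip, _ => false
  | setInt _ _, _ => false
  | setReal x _, y => x == y
  | storeInt _ _ _, _ => false
  | storeReal _ _ _, _ => false
  | seq c d, y => c.writesReal y || d.writesReal y
  | ite _ c d, y => c.writesReal y || d.writesReal y
  | .while _ c, y => c.writesReal y

/-- The integer arrays that a program may write. -/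
def Cmd.writesInts : Cmd → ℕ → Bool
  | skip, _ => false
  | setInt _ _, _ => false
  | setReal _ _, _ => false
  | storeInt a _ _, y => a == y
  | storeReal _ _ _, _ => false
  | seq c d, y => c.writesInts y || d.writesInts y
  | ite _ c d, y => c.writesInts y || d.writesInts y
  | .while _ c, y => c.writesInts y

/-- The real arrays that a program may write. -/
def Cmd.writesReals : Cmd → ℕ → Bool
  | skip, _ => false
  | setInt _ _, _ => false
  | setReal _ _, _ => false
  | storeInt _ _ _, _ => false
  | storeReal a _ _, y => a == y
  | seq c d, y => c.writesReals y || d.writesReals y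
  | ite _ c d, y => c.writesReals y || d.writesReals y
  | .while _ c, y => c.writesReals y

/-- The states `s` and `s'` differ only in registers and arrays that `c` may write. -/
structure Frame (c : Cmd) (s s' : State) : Prop where
  int : ∀ x, c.writesInt x = false → s'.intReg x = s.intReg x
  real : ∀ x, c.writesReal x = false → s'.realReg x = s.realReg x
  ints : ∀ x, c.writesInts x = false → s'.mem.ints x = s.mem.ints x
  reals : ∀ x, c.writesReals x = false → s'.mem.reals x = s.mem.reals x

theorem Frame.refl (c : Cmd) (s : State) : Frame c s s :=
  ⟨fun _ _ => rfl, fun _ _ => rfl, fun _ _ => rfl, fun _ _ => rfl⟩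

theorem Frame.trans {c : Cmd} {s s' s'' : State} (h : Frame c s s') (h' : Frame c s' s'') :
    Frame c s s'' :=
  ⟨fun x hx => (h'.int x hx).trans (h.int x hx), fun x hx => (h'.real x hx).trans (h.real x hx),
    fun x hx => (h'.ints x hx).trans (h.ints x hx),
    fun x hx => (h'.reals x hx).trans (h.reals x hx)⟩

theorem Frame.mono {c d : Cmd} {s s' : State} (h : Frame c s s')
    (h1 : ∀ x, d.writesInt x = false → c.writesInt x = false)
    (h2 : ∀ x, d.writesReal x = false → c.writesReal x = false)
    (h3 : ∀ x, d.writesInts x = false → c.writesInts x = false)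
    (h4 : ∀ x, d.writesReals x = false → c.writesReals x = false) : Frame d s s' :=
  ⟨fun x hx => h.int x (h1 x hx), fun x hx => h.real x (h2 x hx),
    fun x hx => h.ints x (h3 x hx), fun x hx => h.reals x (h4 x hx)⟩

theorem Frame.seq_left {c d : Cmd} {s s' : State} (h : Frame c s s') : Frame (.seq c d) s s' := by
  apply h.mono <;> intro x hx <;>
    simp_all [Cmd.writesInt, Cmd.writesReal, Cmd.writesInts, Cmd.writesReals]

theorem Frame.seq_right {c d : Cmd} {s s' : State} (h : Frame d s s') : Frame (.seq c d) s s' := by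
  apply h.mono <;> intro x hx <;>
    simp_all [Cmd.writesInt, Cmd.writesReal, Cmd.writesInts, Cmd.writesReals]

theorem Frame.ite_left {b : Test} {c d : Cmd} {s s' : State} (h : Frame c s s') :
    Frame (.ite b c d) s s' := by
  apply h.mono <;> intro x hx <;>
    simp_all [Cmd.writesInt, Cmd.writesReal, Cmd.writesInts, Cmd.writesReals]

theorem Frame.ite_right {b : Test} {c d : Cmd} {s s' : State} (h : Frame d s s') :
    Frame (.ite b c d) s s' := by
  apply h.mono <;> intro x hx <;>
    simp_all [Cmd.writesInt, Cmd.writesReal, Cmd.writesInts, Cmd.writesReals]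

theorem Frame.mem_eq {c : Cmd} {s s' : State} (h : Frame c s s')
    (h3 : ∀ x, c.writesInts x = false) (h4 : ∀ x, c.writesReals x = false) : s'.mem = s.mem := by
  have e3 : s'.mem.ints = s.mem.ints := funext fun x => h.ints x (h3 x)
  have e4 : s'.mem.reals = s.mem.reals := funext fun x => h.reals x (h4 x)
  rcases hs : s.mem with ⟨i, r⟩
  rcases hs' : s'.mem with ⟨i', r'⟩
  simp_all

/-- The frame rule of the development. The write sets are Boolean functions of the program text, so
for a concrete program each preservation fact below reduces to `rfl`. -/
theorem Exec.frame {S : ℕ} {c : Cmd} {s s' : State} {t : ℕ} (h : Exec S c s s' t) :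
    Frame c s s' := by
  induction h with
  | skip s => exact Frame.refl _ _
  | setInt s x e he hv =>
    refine ⟨fun y hy => ?_, fun _ _ => rfl, fun _ _ => rfl, fun _ _ => rfl⟩
    have : y ≠ x := by rintro rfl; simp [Cmd.writesInt] at hy
    simp [State.setInt, this]
  | setReal s x e he =>
    refine ⟨fun _ _ => rfl, fun y hy => ?_, fun _ _ => rfl, fun _ _ => rfl⟩
    have : y ≠ x := by rintro rfl; simp [Cmd.writesReal] at hy
    simp [State.setReal, this]
  | storeInt s a i e hi hS he hv =>
    refine ⟨fun _ _ => rfl, fun _ _ => rfl, fun y hy => ?_, fun _ _ => rfl⟩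
    have : y ≠ a := by rintro rfl; simp [Cmd.writesInts] at hy
    simp [State.storeInt, this]
  | storeReal s a i e hi hS he =>
    refine ⟨fun _ _ => rfl, fun _ _ => rfl, fun _ _ => rfl, fun y hy => ?_⟩
    have : y ≠ a := by rintro rfl; simp [Cmd.writesReals] at hy
    simp [State.storeReal, this]
  | seq _ _ ih1 ih2 => exact ih1.seq_left.trans ih2.seq_right
  | iteTrue _ _ _ ih => exact ih.ite_left
  | iteFalse _ _ _ ih => exact ih.ite_right
  | whileTrue _ _ _ _ ih1 ih2 =>
    exact Frame.trans (ih1.mono (fun _ h => h) (fun _ h => h) (fun _ h => h) (fun _ h => h)) ih2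
  | whileFalse => exact Frame.refl _ _

theorem Runs.mono {S : ℕ} {c : Cmd} {s : State} {T T' : ℕ} {Q Q' : State → Prop}
    (h : Runs S c s T Q) (hT : T ≤ T') (hQ : ∀ s', Frame c s s' → Q s' → Q' s') :
    Runs S c s T' Q' := by
  obtain ⟨s', t, he, ht, hq⟩ := h
  exact ⟨s', t, he, ht.trans hT, hQ s' he.frame hq⟩

theorem Runs.seq {S : ℕ} {c d : Cmd} {s : State} {T T' : ℕ} {Q : State → Prop}
    (h : Runs S c s T (fun s' => Runs S d s' T' Q)) : Runs S (.seq c d) s (T + T') Q := by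
  obtain ⟨s', t, he, ht, s'', t', he', ht', hq⟩ := h
  exact ⟨s'', t + t', .seq he he', by omega, hq⟩

theorem Runs.seq' {S : ℕ} {c d : Cmd} {s : State} {T T' : ℕ} {P Q : State → Prop}
    (h : Runs S c s T P) (h' : ∀ s', Frame c s s' → P s' → Runs S d s' T' Q) :
    Runs S (.seq c d) s (T + T') Q :=
  Runs.seq (h.mono le_rfl h')

theorem Runs.ite {S : ℕ} {b : Test} {c d : Cmd} {s : State} {T : ℕ} {Q : State → Prop}
    (hb : b.Legal S s) (h : b.Holds s → Runs S c s T Q) (h' : ¬ b.Holds s → Runs S d s T Q) :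
    Runs S (.ite b c d) s (b.cost + 1 + T) Q := by
  by_cases hh : b.Holds s
  · obtain ⟨s', t, he, ht, hq⟩ := h hh
    exact ⟨s', _, .iteTrue hb hh he, by omega, hq⟩
  · obtain ⟨s', t, he, ht, hq⟩ := h' hh
    exact ⟨s', _, .iteFalse hb hh he, by omega, hq⟩

/-- The index `m` is fuel: each round must consume one unit, so with no fuel left the test has to
fail. The invariant thus yields termination and the bound on the number of rounds at once. -/
theorem Runs.whileLoop {S : ℕ} {b : Test} {c : Cmd} {T : ℕ} {Q : State → Prop}
    (I : ℕ → State → Prop) (m : ℕ) (s : State) (hI : I m s)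
    (step : ∀ m s', Frame c s s' → I m s' → b.Legal S s' ∧
      (b.Holds s' → ∃ m', m = m' + 1 ∧ Runs S c s' T (I m')) ∧ (¬ b.Holds s' → Q s')) :
    Runs S (.while b c) s (m * (b.cost + 1 + T) + (b.cost + 1)) Q := by
  have key : ∀ m s', Frame c s s' → I m s' →
      Runs S (.while b c) s' (m * (b.cost + 1 + T) + (b.cost + 1)) Q := by
    intro m
    induction m with
    | zero =>
      intro s' hf hI
      obtain ⟨hl, ht, hn⟩ := step 0 s' hf hI
      by_cases hh : b.Holds s'
      · obtain ⟨m', hm, -⟩ := ht hh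
        omega
      · exact ⟨s', _, .whileFalse hl hh, by omega, hn hh⟩
    | succ m ih =>
      intro s' hf hI
      obtain ⟨hl, ht, hn⟩ := step (m + 1) s' hf hI
      by_cases hh : b.Holds s'
      · obtain ⟨m', hm, s1, t1, he1, ht1, hI1⟩ := ht hh
        obtain rfl : m = m' := by omega
        obtain ⟨s2, t2, he2, ht2, hq⟩ := ih s1 (hf.trans he1.frame) hI1
        refine ⟨s2, _, .whileTrue hl hh he1 he2, ?_, hq⟩
        rw [Nat.succ_mul]
        omega
      · exact ⟨s', _, .whileFalse hl hh, by omega, hn hh⟩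
  exact key m s (Frame.refl _ _) hI

/-! ### Loop-free programs -/

/-- Weakest preconditions of loop-free programs. -/
def wp (S : ℕ) : Cmd → (State → Prop) → State → Prop
  | .skip, Q, s => Q s
  | .setInt x e, Q, s => e.Legal S s ∧ e.eval s < S ∧ Q (s.setInt x (e.eval s))
  | .setReal x e, Q, s => e.Legal S s ∧ Q (s.setReal x (e.eval s))
  | .storeInt a i e, Q, s => i.Legal S s ∧ i.eval s < S ∧ e.Legal S s ∧ e.eval s < S ∧
      Q (s.storeInt a (i.eval s) (e.eval s))
  | .storeReal a i e, Q, s => i.Legal S s ∧ i.eval s < S ∧ e.Legal S s ∧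
      Q (s.storeReal a (i.eval s) (e.eval s))
  | .seq c d, Q, s => wp S c (wp S d Q) s
  | .ite b c d, Q, s => b.Legal S s ∧ (b.Holds s → wp S c Q s) ∧ (¬ b.Holds s → wp S d Q s)
  | .while _ _, _, _ => False

/-- An upper bound for the number of steps of a loop-free program. -/
def Cmd.maxCost : Cmd → ℕ
  | skip => 1
  | setInt _ e => e.cost + 1
  | setReal _ e => e.cost + 1
  | storeInt _ i e => i.cost + e.cost + 1
  | storeReal _ i e => i.cost + e.cost + 1
  | seq c d => c.maxCost + d.maxCost
  | ite b c d => b.cost + 1 + max c.maxCost d.maxCost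
  | .while _ _ => 0

/-- Reduces straight-line code to a proposition that `simp` can evaluate. Loops have precondition
`False`, so their value 0 in `maxCost` does no harm. -/
theorem Runs.of_wp {S : ℕ} {c : Cmd} {s : State} {Q : State → Prop} (h : wp S c Q s) :
    Runs S c s c.maxCost Q := by
  induction c generalizing s Q with
  | skip => exact ⟨s, _, .skip s, le_rfl, h⟩
  | setInt x e => exact ⟨_, _, .setInt s x e h.1 h.2.1, le_rfl, h.2.2⟩
  | setReal x e => exact ⟨_, _, .setReal s x e h.1, le_rfl, h.2⟩
  | storeInt a i e =>
    exact ⟨_, _, .storeInt s a i e h.1 h.2.1 h.2.2.1 h.2.2.2.1, le_rfl, h.2.2.2.2⟩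
  | storeReal a i e => exact ⟨_, _, .storeReal s a i e h.1 h.2.1 h.2.2.1, le_rfl, h.2.2.2⟩
  | seq c d ihc ihd => exact Runs.seq ((ihc h).mono le_rfl fun s' _ h' => ihd h')
  | ite b c d ihc ihd =>
    exact Runs.ite h.1 (fun hb => (ihc (h.2.1 hb)).mono (le_max_left _ _) fun _ _ h => h)
      (fun hb => (ihd (h.2.2 hb)).mono (le_max_right _ _) fun _ _ h => h)
  | _ => exact h.elim

/-! ### Counting loops -/

/-- Run `c` with integer register `x` equal to `0, …, m - 1`, where register `y` holds `m`. -/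
def forLoop (x y : ℕ) (c : Cmd) : Cmd :=
  .seq (.setInt x (.const 0)) (.while (.intLt (.reg x) (.reg y))
    (.seq c (.setInt x (.add (.reg x) (.const 1)))))

/-- The 8 extra steps per round are 4 for the test and 4 for the increment; the final 6 are 2 for
the initialization and 4 for the last test. The invariant must not depend on the counter register
(`hIx`), whose value is handed to `step` separately. -/
theorem Runs.forLoop {S x y : ℕ} {c : Cmd} {T m : ℕ} {s : State} (I : ℕ → State → Prop)
    (hx : c.writesInt x = false) (hy : c.writesInt y = false) (hxy : x ≠ y)
    (hm : s.intReg y = m) (hS : m < S)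
    (hI0 : I 0 s) (hIx : ∀ i s v, I i s → I i (s.setInt x v))
    (step : ∀ i s', i < m → s'.intReg x = i →
      Frame (.seq (.setInt x (.const 0)) c) s s' → I i s' → Runs S c s' T (I (i + 1))) :
    Runs S (forLoop x y c) s (m * (T + 8) + 6) (I m) := by
  have h1 : Runs S (.setInt x (.const 0)) s 2 (fun s' => s' = s.setInt x 0) :=
    ⟨_, _, .setInt s x _ trivial (by simp [IntExpr.eval]; omega), le_rfl, rfl⟩
  refine (Runs.seq' h1 (T' := m * (T + 8) + 4) ?_).mono (by omega) fun _ _ h => h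
  rintro s1 hf1 rfl
  have hw := Runs.whileLoop (S := S) (b := .intLt (.reg x) (.reg y))
    (c := .seq c (.setInt x (.add (.reg x) (.const 1)))) (T := T + 4) (Q := I m)
    (fun k s' => ∃ i, k + i = m ∧ s'.intReg x = i ∧ I i s') m (s.setInt x 0)
    ⟨0, rfl, by simp [State.setInt], hIx _ _ _ hI0⟩ ?_
  · refine hw.mono ?_ fun _ _ h => h
    simp only [Test.cost, IntExpr.cost]
    ring_nf
    omega
  · rintro k s' hf ⟨i, hk, hi, hI⟩
    have hy' : s'.intReg y = m := by
      rw [hf.int y (by simp [Cmd.writesInt, hy, hxy]), ← hm]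
      simp [State.setInt, Ne.symm hxy]
    refine ⟨⟨trivial, trivial⟩, fun hb => ?_, fun hb => ?_⟩
    · simp only [Test.Holds, IntExpr.eval, hi, hy'] at hb
      refine ⟨k - 1, by omega, ?_⟩
      have hff : Frame (.seq (.setInt x (.const 0)) c) s s' := by
        have hf1' : Frame (.seq (.setInt x (.const 0)) c) s (s.setInt x 0) := hf1.seq_left
        refine hf1'.trans (hf.mono ?_ ?_ ?_ ?_) <;> intro z hz <;>
          simp_all [Cmd.writesInt, Cmd.writesReal, Cmd.writesInts, Cmd.writesReals]
      refine Runs.seq' (step i s' hb hi hff hI) ?_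
      intro s2 hf2 hI2
      have hx2 : s2.intReg x = i := by rw [hf2.int x hx, hi]
      refine ⟨_, _, .setInt s2 x _ ⟨trivial, trivial⟩ (by simp [IntExpr.eval, hx2]; omega),
        le_rfl, i + 1, by omega, ?_, ?_⟩
      · simp [State.setInt, IntExpr.eval, hx2]
      · exact hIx _ _ _ hI2
    · simp only [Test.Holds, IntExpr.eval, hi, hy'] at hb
      obtain rfl : i = m := by omega
      exact hI

/-! ### Reading updated states -/

theorem State.setInt_intReg (s : State) (x v y : ℕ) :
    (s.setInt x v).intReg y = if y = x then v else s.intReg y := by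
  simp [State.setInt, Function.update_apply]

theorem State.setInt_realReg (s : State) (x v : ℕ) : (s.setInt x v).realReg = s.realReg := rfl

theorem State.setInt_mem (s : State) (x v : ℕ) : (s.setInt x v).mem = s.mem := rfl

theorem State.setReal_intReg (s : State) (x : ℕ) (v : ℝ) : (s.setReal x v).intReg = s.intReg := rfl

theorem State.setReal_realReg (s : State) (x : ℕ) (v : ℝ) (y : ℕ) :
    (s.setReal x v).realReg y = if y = x then v else s.realReg y := by
  simp [State.setReal, Function.update_apply]

theorem State.setReal_mem (s : State) (x : ℕ) (v : ℝ) : (s.setReal x v).mem = s.mem := rfl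

theorem State.storeInt_intReg (s : State) (a i v : ℕ) : (s.storeInt a i v).intReg = s.intReg := rfl

theorem State.storeInt_realReg (s : State) (a i v : ℕ) :
    (s.storeInt a i v).realReg = s.realReg := rfl

theorem State.storeInt_reals (s : State) (a i v : ℕ) :
    (s.storeInt a i v).mem.reals = s.mem.reals := rfl

theorem State.storeInt_ints (s : State) (a i v b : ℕ) : (s.storeInt a i v).mem.ints b =
    if b = a then Function.update (s.mem.ints a) i v else s.mem.ints b := by
  simp [State.storeInt, Function.update_apply]

theorem State.storeReal_intReg (s : State) (a i : ℕ) (v : ℝ) :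
    (s.storeReal a i v).intReg = s.intReg := rfl

theorem State.storeReal_realReg (s : State) (a i : ℕ) (v : ℝ) :
    (s.storeReal a i v).realReg = s.realReg := rfl

theorem State.storeReal_ints (s : State) (a i : ℕ) (v : ℝ) :
    (s.storeReal a i v).mem.ints = s.mem.ints := rfl

theorem State.storeReal_reals (s : State) (a i : ℕ) (v : ℝ) (b : ℕ) :
    (s.storeReal a i v).mem.reals b =
    if b = a then Function.update (s.mem.reals a) i v else s.mem.reals b := by
  simp [State.storeReal, Function.update_apply]

attribute [simp] IntExpr.eval RealExpr.eval Test.Holds IntExpr.Legal RealExpr.Legal Test.Legal wp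
  State.setInt_intReg State.setInt_realReg State.setInt_mem State.setReal_intReg
  State.setReal_realReg State.setReal_mem State.storeInt_intReg State.storeInt_realReg
  State.storeInt_reals State.storeInt_ints State.storeReal_intReg State.storeReal_realReg
  State.storeReal_ints State.storeReal_reals

end RealRAM

/-! ## Positions of reals relative to a finite grid of values -/

open Classical in
/-- The position of `v` relative to the values `Z 0, …, Z (N - 1)`: odd positions are grid values,
even positions are the gaps between them. -/
noncomputable def gridPos (Z : ℕ → ℝ) (N : ℕ) (v : ℝ) : ℕ :=
  2 * ((Finset.range N).filter (fun i => Z i < v)).card + if ∃ i < N, Z i = v then 1 else 0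

theorem card_filter_lt_of_lt {Z : ℕ → ℝ} {N : ℕ} {a q : ℝ} (ha : ∃ i < N, Z i = a) (h : a < q) :
    ((Finset.range N).filter (fun i => Z i < a)).card <
      ((Finset.range N).filter (fun i => Z i < q)).card := by
  obtain ⟨i, hi, rfl⟩ := ha
  refine Finset.card_lt_card (Finset.ssubset_iff_of_subset ?_ |>.2 ⟨i, by simp [hi, h], by simp⟩)
  intro j hj
  simp only [Finset.mem_filter] at hj ⊢
  exact ⟨hj.1, hj.2.trans h⟩

theorem card_filter_lt_mono {Z : ℕ → ℝ} {N : ℕ} {a q : ℝ} (h : a ≤ q) :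
    ((Finset.range N).filter (fun i => Z i < a)).card ≤
      ((Finset.range N).filter (fun i => Z i < q)).card := by
  refine Finset.card_le_card fun j hj => ?_
  simp only [Finset.mem_filter] at hj ⊢
  exact ⟨hj.1, hj.2.trans_le h⟩

theorem gridPos_lt_right {Z : ℕ → ℝ} {N : ℕ} {a q : ℝ} (ha : ∃ i < N, Z i = a) (h : a < q) :
    gridPos Z N a < gridPos Z N q := by
  have := card_filter_lt_of_lt ha h
  unfold gridPos
  split_ifs <;> omega

/-- A value in the gap just below `a` can have as many grid values beneath it as `a` itself. The
parity bit of the grid value decides this case. -/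
theorem gridPos_lt_left {Z : ℕ → ℝ} {N : ℕ} {a q : ℝ} (ha : ∃ i < N, Z i = a) (h : q < a) :
    gridPos Z N q < gridPos Z N a := by
  unfold gridPos
  rw [if_pos ha]
  have := card_filter_lt_mono (Z := Z) (N := N) h.le
  split_ifs with hq
  · have := card_filter_lt_of_lt hq h
    omega
  · omega

theorem gridPos_mono {Z : ℕ → ℝ} {N : ℕ} {a q : ℝ} (h : a ≤ q) :
    gridPos Z N a ≤ gridPos Z N q := by
  rcases h.eq_or_lt with rfl | h
  · rfl
  by_cases ha : ∃ i < N, Z i = a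
  · exact (gridPos_lt_right ha h).le
  · have := card_filter_lt_mono (Z := Z) (N := N) h.le
    unfold gridPos
    rw [if_neg ha]
    omega

/-- Makes the discretization lossless: against a grid value, comparing positions is the same as
comparing reals. Hence a box with grid coordinates contains all or none of the points that share
their two positions. -/
theorem gridPos_le_iff {Z : ℕ → ℝ} {N : ℕ} {a q : ℝ} (ha : ∃ i < N, Z i = a) :
    gridPos Z N a ≤ gridPos Z N q ↔ a ≤ q :=
  ⟨fun h => not_lt.1 fun h' => absurd (gridPos_lt_left ha h') (not_lt.2 h), gridPos_mono⟩

theorem le_gridPos_iff {Z : ℕ → ℝ} {N : ℕ} {a q : ℝ} (ha : ∃ i < N, Z i = a) :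
    gridPos Z N q ≤ gridPos Z N a ↔ q ≤ a :=
  ⟨fun h => not_lt.1 fun h' => absurd (gridPos_lt_right ha h') (not_lt.2 h), gridPos_mono⟩

/-- A value that does not exceed the largest grid value is never beyond the last grid position. This
excludes the gap at the upper end, so `2 * N` positions suffice for all points of the rectangle. -/
theorem gridPos_lt_two_mul {Z : ℕ → ℝ} {N : ℕ} {v : ℝ} (h : ∃ i < N, v ≤ Z i) :
    gridPos Z N v < 2 * N := by
  obtain ⟨i, hi, hv⟩ := h
  have : ((Finset.range N).filter (fun i => Z i < v)).card < N := by
    have := Finset.card_lt_card (s := (Finset.range N).filter (fun i => Z i < v))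
      (t := Finset.range N)
      (Finset.ssubset_iff_of_subset (Finset.filter_subset _ _) |>.2 ⟨i, by simp [hi], by simp [hv]⟩)
    simpa using this
  unfold gridPos
  split_ifs <;> omega

/-- Translates the outcome `lo` of a binary search in a sorted array into the position: `lo` is the
number of smaller grid values, and one equality test decides the parity. -/
theorem gridPos_eq {Z : ℕ → ℝ} {N : ℕ} {v : ℝ} {lo : ℕ}
    (hZ : ∀ i j, i ≤ j → j < N → Z i ≤ Z j) (hlo : lo ≤ N) (h1 : ∀ i < lo, Z i < v)
    (h2 : ∀ i, lo ≤ i → i < N → v ≤ Z i) [Decidable (lo < N ∧ Z lo = v)] :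
    gridPos Z N v = 2 * lo + if lo < N ∧ Z lo = v then 1 else 0 := by
  have hc : (Finset.range N).filter (fun i => Z i < v) = Finset.range lo := by
    ext i
    simp only [Finset.mem_filter, Finset.mem_range]
    refine ⟨fun h => ?_, fun h => ⟨by omega, h1 i h⟩⟩
    by_contra hi
    exact absurd (h2 i (by omega) h.1) (not_le.2 h.2)
  have hi : (∃ i < N, Z i = v) ↔ (lo < N ∧ Z lo = v) := by
    constructor
    · rintro ⟨i, hi, rfl⟩
      have hli : lo ≤ i := by
        by_contra h
        exact lt_irrefl _ (h1 i (by omega))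
      exact ⟨by omega, le_antisymm (hZ _ _ hli hi) (h2 lo le_rfl (by omega))⟩
    · exact fun h => ⟨lo, h⟩
  unfold gridPos
  rw [hc, Finset.card_range]
  by_cases h : lo < N ∧ Z lo = v
  · rw [if_pos h, if_pos (hi.2 h)]
  · rw [if_neg h, if_neg fun h' => h (hi.1 h')]

/-! ## Boxes -/

/-- Four coordinates of a possibly degenerate axis-parallel rectangle. -/
structure Box where
  x₀ : ℝ
  x₁ : ℝ
  y₀ : ℝ
  y₁ : ℝ

/-- The area of a box. -/
def Box.area (b : Box) : ℝ := (b.x₁ - b.x₀) * (b.y₁ - b.y₀)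

/-- The box contains the pair of positions `(px, py)`, where `fx` and `fy` assign positions to
coordinates. -/
def Box.Covers (fx fy : ℝ → ℕ) (b : Box) (px py : ℕ) : Prop :=
  fx b.x₀ ≤ px ∧ px ≤ fx b.x₁ ∧ fy b.y₀ ≤ py ∧ py ≤ fy b.y₁

/-- The interior of the product is the product of open intervals, and nondegeneracy turns the
inclusion of regions into four inequalities. All later reasoning uses only these coordinates. -/
theorem Rect.isEmptyIn_iff {R A : Rect} {P : Set (ℝ × ℝ)} :
    R.IsEmptyIn A P ↔ (A.x₀ ≤ R.x₀ ∧ R.x₁ ≤ A.x₁ ∧ A.y₀ ≤ R.y₀ ∧ R.y₁ ≤ A.y₁) ∧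
      ∀ p ∈ P, ¬ ((R.x₀ < p.1 ∧ p.1 < R.x₁) ∧ R.y₀ < p.2 ∧ p.2 < R.y₁) := by
  have hne : (Set.Icc R.x₀ R.x₁ ×ˢ Set.Icc R.y₀ R.y₁).Nonempty :=
    ⟨(R.x₀, R.y₀), by simp [R.hx.le, R.hy.le]⟩
  unfold Rect.IsEmptyIn Rect.region
  rw [interior_prod_eq, interior_Icc, interior_Icc, Set.prod_subset_prod_iff,
    Set.Icc_subset_Icc_iff R.hx.le, Set.Icc_subset_Icc_iff R.hy.le, Set.disjoint_right]
  have h1 : Set.Icc R.x₀ R.x₁ ≠ ∅ := (Set.nonempty_Icc.2 R.hx.le).ne_empty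
  have h2 : Set.Icc R.y₀ R.y₁ ≠ ∅ := (Set.nonempty_Icc.2 R.hy.le).ne_empty
  simp only [h1, h2, or_false, Set.mem_prod, Set.mem_Ioo]
  refine and_congr ?_ Iff.rfl
  tauto

/-! ## The sweep that generates all maximal empty rectangles -/

/-- The coordinates `(X i, Y i)`, `i < N`, are those of the points of `P` and of the lower left and
upper right corners of `A`, sorted by `Y`; `Z` is sorted and contains all values of `X`. -/
structure Grid (A : Rect) (P : Set (ℝ × ℝ)) (N : ℕ) (X Y Z : ℕ → ℝ) : Prop where
  monoY : ∀ i j, i ≤ j → j < N → Y i ≤ Y j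
  monoZ : ∀ i j, i ≤ j → j < N → Z i ≤ Z j
  memZ : ∀ i < N, ∃ j < N, Z j = X i
  mem : ∀ i < N, (A.x₀ ≤ X i ∧ X i ≤ A.x₁) ∧ A.y₀ ≤ Y i ∧ Y i ≤ A.y₁
  pts : ∀ p ∈ P, ∃ i < N, (X i, Y i) = p
  cases : ∀ i < N, (X i, Y i) ∈ P ∨ (X i = A.x₀ ∧ Y i = A.y₀) ∨ (X i = A.x₁ ∧ Y i = A.y₁)
  corner₀ : ∃ i < N, X i = A.x₀ ∧ Y i = A.y₀
  corner₁ : ∃ i < N, X i = A.x₁ ∧ Y i = A.y₁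

/-- The left end of the window above the anchor `(xa, ya)` after `k` points of the sweep. -/
noncomputable def sweepL (X Y : ℕ → ℝ) (a xa ya : ℝ) : ℕ → ℝ
  | 0 => a
  | k + 1 => if ya < Y k ∧ X k ≤ xa then max (sweepL X Y a xa ya k) (X k) else sweepL X Y a xa ya k

/-- The right end of the window above the anchor `(xa, ya)` after `k` points of the sweep. -/
noncomputable def sweepR (X Y : ℕ → ℝ) (a xa ya : ℝ) : ℕ → ℝ
  | 0 => a
  | k + 1 => if ya < Y k ∧ xa < X k then min (sweepR X Y a xa ya k) (X k) else sweepR X Y a xa ya k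

theorem sweepL_mono {X Y : ℕ → ℝ} {a xa ya : ℝ} : Monotone (sweepL X Y a xa ya) := by
  refine monotone_nat_of_le_succ fun k => ?_
  simp only [sweepL]
  split_ifs <;> simp

theorem sweepR_anti {X Y : ℕ → ℝ} {a xa ya : ℝ} : Antitone (sweepR X Y a xa ya) := by
  refine antitone_nat_of_succ_le fun k => ?_
  simp only [sweepR]
  split_ifs <;> simp

/-- When point `j` is passed, the window end on its side of the anchor moves at least to `X j`, and
later steps only shrink the window. -/
theorem sweep_avoids {X Y : ℕ → ℝ} {a a' xa ya : ℝ} {j k : ℕ} (hjk : j < k) (hj : ya < Y j) :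
    X j ≤ sweepL X Y a xa ya k ∨ sweepR X Y a' xa ya k ≤ X j := by
  by_cases h : X j ≤ xa
  · refine .inl (le_trans ?_ (sweepL_mono (Nat.succ_le_of_lt hjk)))
    simp [sweepL, hj, h]
  · refine .inr (le_trans (sweepR_anti (Nat.succ_le_of_lt hjk)) ?_)
    simp [sweepR, hj, not_le.1 h]

/-- Window ends must stay grid abscissas, because positions decide containment exactly only against
grid values. -/
theorem sweepL_mem {X Y : ℕ → ℝ} {a xa ya : ℝ} {N k : ℕ} (ha : ∃ i < N, X i = a) (hk : k ≤ N) :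
    ∃ i < N, X i = sweepL X Y a xa ya k := by
  induction k with
  | zero => exact ha
  | succ k ih =>
    simp only [sweepL]
    split_ifs
    · rcases max_choice (sweepL X Y a xa ya k) (X k) with h | h
      · rw [h]; exact ih (by omega)
      · rw [h]; exact ⟨k, by omega, rfl⟩
    · exact ih (by omega)

theorem sweepR_mem {X Y : ℕ → ℝ} {a xa ya : ℝ} {N k : ℕ} (ha : ∃ i < N, X i = a) (hk : k ≤ N) :
    ∃ i < N, X i = sweepR X Y a xa ya k := by
  induction k with
  | zero => exact ha
  | succ k ih =>
    simp only [sweepR]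
    split_ifs
    · rcases min_choice (sweepR X Y a xa ya k) (X k) with h | h
      · rw [h]; exact ih (by omega)
      · rw [h]; exact ⟨k, by omega, rfl⟩
    · exact ih (by omega)

/-- The `k`-th box of the sweep from the anchor `(xa, ya)`. -/
noncomputable def sweepBox (A : Rect) (X Y : ℕ → ℝ) (xa ya : ℝ) (k : ℕ) : Box :=
  ⟨sweepL X Y A.x₀ xa ya k, sweepR X Y A.x₁ xa ya k, ya, Y k⟩

/-- A nondegenerate box with coordinates in the grid and no point of `P` in its interior. -/
structure Box.Valid (P : Set (ℝ × ℝ)) (N : ℕ) (X Y : ℕ → ℝ) (b : Box) : Prop where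
  hx : b.x₀ < b.x₁
  hy : b.y₀ < b.y₁
  mx₀ : ∃ i < N, X i = b.x₀
  mx₁ : ∃ i < N, X i = b.x₁
  my₀ : ∃ i < N, Y i = b.y₀
  my₁ : ∃ i < N, Y i = b.y₁
  empty : ∀ p ∈ P, ¬ ((b.x₀ < p.1 ∧ p.1 < b.x₁) ∧ b.y₀ < p.2 ∧ p.2 < b.y₁)

section Sweep

variable {A : Rect} {P : Set (ℝ × ℝ)} {N : ℕ} {X Y Z : ℕ → ℝ}

/-- A point strictly below the upper side precedes `k` in the order by height, so it has already cut
the window and cannot be in the interior. -/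
theorem Grid.sweepBox_valid (g : Grid A P N X Y Z) {xa ya : ℝ} {k : ℕ} (hk : k < N)
    (hya : ∃ i < N, Y i = ya) (hy : ya < Y k)
    (hx : sweepL X Y A.x₀ xa ya k < sweepR X Y A.x₁ xa ya k) :
    (sweepBox A X Y xa ya k).Valid P N X Y where
  hx := hx
  hy := hy
  mx₀ := sweepL_mem (g.corner₀.imp fun _ h => ⟨h.1, h.2.1⟩) hk.le
  mx₁ := sweepR_mem (g.corner₁.imp fun _ h => ⟨h.1, h.2.1⟩) hk.le
  my₀ := hya
  my₁ := ⟨k, hk, rfl⟩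
  empty := by
    rintro p hp ⟨⟨h1, h2⟩, h3, h4⟩
    obtain ⟨j, hj, rfl⟩ := g.pts p hp
    simp only [sweepBox] at h1 h2 h3 h4
    have hjk : j < k := by
      by_contra h
      exact absurd (g.monoY k j (not_lt.1 h) hj) (not_le.2 h4)
    rcases sweep_avoids (X := X) (a := A.x₀) (a' := A.x₁) (xa := xa) hjk h3 with h | h
    · exact absurd h1 (not_lt.2 h)
    · exact absurd h2 (not_lt.2 h)

/-- A box without grid points in its interior whose lower side is at the height of an anchor
is contained in a box of the sweep from this anchor. -/
theorem Grid.exists_sweepBox (g : Grid A P N X Y Z) {xa ya x₀ x₁ y₁ : ℝ} (h0 : x₀ ≤ xa)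
    (h1 : xa < x₁) (hx₀ : A.x₀ ≤ x₀) (hx₁ : x₁ ≤ A.x₁) (hy₁ : y₁ ≤ A.y₁)
    (he : ∀ j < N, ¬ ((x₀ < X j ∧ X j < x₁) ∧ ya < Y j ∧ Y j < y₁)) :
    ∃ k < N, y₁ ≤ Y k ∧ sweepL X Y A.x₀ xa ya k ≤ x₀ ∧ x₁ ≤ sweepR X Y A.x₁ xa ya k := by
  classical
  have hex : ∃ k, k < N ∧ y₁ ≤ Y k := by
    obtain ⟨k, hk, -, h⟩ := g.corner₁
    exact ⟨k, hk, h ▸ hy₁⟩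
  -- The first index whose height reaches `y₁`: all earlier points are strictly lower, so points
  -- tied in height at the top have not narrowed the window yet.
  refine ⟨Nat.find hex, (Nat.find_spec hex).1, (Nat.find_spec hex).2, ?_⟩
  have hlt : ∀ j < Nat.find hex, Y j < y₁ := fun j hj => by
    have := Nat.find_min hex hj
    have hN := (Nat.find_spec hex).1
    by_contra h
    exact this ⟨by omega, not_lt.1 h⟩
  have key : ∀ k ≤ Nat.find hex,
      sweepL X Y A.x₀ xa ya k ≤ x₀ ∧ x₁ ≤ sweepR X Y A.x₁ xa ya k := by
    intro k
    induction k with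
    | zero => exact fun _ => ⟨hx₀, hx₁⟩
    | succ k ih =>
      intro hk
      obtain ⟨ih1, ih2⟩ := ih (by omega)
      have hkN : k < N := by have := (Nat.find_spec hex).1; omega
      have hk' := he k hkN
      have hYk := hlt k (by omega)
      -- Points straight above the anchor count as left. This is why `x₀ = xa` is allowed while `xa
      -- < x₁` must be strict.
      simp only [sweepL, sweepR]
      constructor
      · split_ifs with hc
        · refine max_le ih1 (not_lt.1 fun hlt' => hk' ⟨⟨hlt', ?_⟩, hc.1, hYk⟩)
          exact hc.2.trans_lt h1
        · exact ih1
      · split_ifs with hc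
        · refine le_min ih2 (not_lt.1 fun hlt' => hk' ⟨⟨?_, hlt'⟩, hc.1, hYk⟩)
          exact h0.trans_lt hc.2
        · exact ih2
  exact key _ le_rfl

/-- Every empty rectangle is contained in a box of the sweep from a grid point or from the
projection of a grid point to the lower side of `A`. -/
theorem Grid.exists_anchor (g : Grid A P N X Y Z) {R : Rect} (hR : R.IsEmptyIn A P) :
    ∃ i < N, ∃ ya, (ya = Y i ∨ ya = A.y₀) ∧ ∃ k < N, ya ≤ R.y₀ ∧ R.y₁ ≤ Y k ∧
      sweepL X Y A.x₀ (X i) ya k ≤ R.x₀ ∧ R.x₁ ≤ sweepR X Y A.x₁ (X i) ya k := by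
  classical
  rw [Rect.isEmptyIn_iff] at hR
  obtain ⟨⟨hx₀, hx₁, hy₀, hy₁⟩, hP⟩ := hR
  have he : ∀ j < N, ¬ ((R.x₀ < X j ∧ X j < R.x₁) ∧ R.y₀ < Y j ∧ Y j < R.y₁) := by
    rintro j hj ⟨⟨h1, h2⟩, h3, h4⟩
    rcases g.cases j hj with h | h | h
    · exact hP _ h ⟨⟨h1, h2⟩, h3, h4⟩
    · linarith [h.1]
    · linarith [h.1]
  -- Pushing the lower side down either hits a grid point, which becomes the anchor, or reaches the
  -- lower side of `A`.
  by_cases hS : ∃ i < N, Y i ≤ R.y₀ ∧ R.x₀ < X i ∧ X i < R.x₁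
  · obtain ⟨i, hi, hmax⟩ := Finset.exists_max_image
      ((Finset.range N).filter fun i => Y i ≤ R.y₀ ∧ R.x₀ < X i ∧ X i < R.x₁) Y
      (by obtain ⟨i, h1, h2⟩ := hS; exact ⟨i, by simpa [h1] using h2⟩)
    simp only [Finset.mem_filter, Finset.mem_range] at hi hmax
    obtain ⟨hiN, hi1, hi2, hi3⟩ := hi
    obtain ⟨k, hk, hk1, hk2, hk3⟩ := g.exists_sweepBox (xa := X i) (ya := Y i) (y₁ := R.y₁)
      hi2.le hi3 hx₀ hx₁ hy₁ (by
        rintro j hj ⟨⟨h1, h2⟩, h3, h4⟩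
        by_cases h : Y j ≤ R.y₀
        · exact absurd (hmax j ⟨hj, h, h1, h2⟩) (not_le.2 h3)
        · exact he j hj ⟨⟨h1, h2⟩, not_le.1 h, h4⟩)
    exact ⟨i, hiN, Y i, .inl rfl, k, hk, hi1, hk1, hk2, hk3⟩
  -- With nothing below, an anchor abscissa is still needed. The left side is moved to the largest
  -- grid abscissa not beyond it; no grid point lies strictly between, so the rectangle stays empty,
  -- and the anchor sits on its left side.
  · obtain ⟨i, hi, hmax⟩ := Finset.exists_max_image
      ((Finset.range N).filter fun i => X i ≤ R.x₀) X
      (by obtain ⟨i, h1, h2, -⟩ := g.corner₀; exact ⟨i, by simp [h1, h2, hx₀]⟩)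
    simp only [Finset.mem_filter, Finset.mem_range] at hi hmax
    obtain ⟨hiN, hi1⟩ := hi
    obtain ⟨k, hk, hk1, hk2, hk3⟩ := g.exists_sweepBox (x₀ := X i) (xa := X i) (ya := A.y₀)
      (y₁ := R.y₁) le_rfl (hi1.trans_lt R.hx) (g.mem i hiN).1.1 hx₁ hy₁ (by
        rintro j hj ⟨⟨h1, h2⟩, h3, h4⟩
        by_cases h : X j ≤ R.x₀
        · exact absurd (hmax j ⟨hj, h⟩) (not_le.2 h1)
        · by_cases h' : Y j ≤ R.y₀
          · exact hS ⟨j, hj, h', not_le.1 h, h2⟩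
          · exact he j hj ⟨⟨not_le.1 h, h2⟩, not_le.1 h', h4⟩)
    exact ⟨i, hiN, A.y₀, .inr rfl, k, hk, hy₀, hk1, hk2.trans hi1, hk3⟩

/-- Every point of `A` lies in an empty rectangle. -/
theorem Grid.exists_isEmptyIn (g : Grid A P N X Y Z) {q : ℝ × ℝ} (hq : q ∈ A.region) :
    ∃ R : Rect, R.IsEmptyIn A P ∧ q ∈ R.region := by
  classical
  obtain ⟨⟨hq1, hq2⟩, hq3, hq4⟩ := hq
  -- A slab of full height between consecutive abscissas works. It extends to the right of `q`,
  -- except when `q` is on the right side of `A` and it must extend to the left.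
  rcases hq2.eq_or_lt with hq2' | hq2'
  · obtain ⟨i, hi, hmax⟩ := Finset.exists_max_image
      ((Finset.range N).filter fun i => X i < A.x₁) X
      (by obtain ⟨i, h1, h2, -⟩ := g.corner₀; exact ⟨i, by simp [h1, h2, A.hx]⟩)
    simp only [Finset.mem_filter, Finset.mem_range] at hi hmax
    refine ⟨⟨X i, A.x₁, A.y₀, A.y₁, hi.2, A.hy⟩, Rect.isEmptyIn_iff.2
      ⟨⟨(g.mem i hi.1).1.1, le_rfl, le_rfl, le_rfl⟩, ?_⟩, ?_⟩
    · rintro p hp ⟨⟨h1, h2⟩, -⟩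
      obtain ⟨j, hj, rfl⟩ := g.pts p hp
      exact absurd (hmax j ⟨hj, h2⟩) (not_le.2 h1)
    · exact ⟨⟨by linarith [hi.2], hq2⟩, hq3, hq4⟩
  · obtain ⟨i, hi, hmin⟩ := Finset.exists_min_image
      ((Finset.range N).filter fun i => q.1 < X i) X
      (by obtain ⟨i, h1, h2, -⟩ := g.corner₁; exact ⟨i, by simp [h1, h2, hq2']⟩)
    simp only [Finset.mem_filter, Finset.mem_range] at hi hmin
    refine ⟨⟨q.1, X i, A.y₀, A.y₁, hi.2, A.hy⟩, Rect.isEmptyIn_iff.2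
      ⟨⟨hq1, (g.mem i hi.1).1.2, le_rfl, le_rfl⟩, ?_⟩, ?_⟩
    · rintro p hp ⟨⟨h1, h2⟩, -⟩
      obtain ⟨j, hj, rfl⟩ := g.pts p hp
      exact absurd (hmin j ⟨hj, h1⟩) (not_le.2 h2)
    · exact ⟨⟨le_rfl, hi.2.le⟩, hq3, hq4⟩

end Sweep

/-! ## The table of best boxes -/

/-- The cell of the table for node `v` of the segment tree over the horizontal positions and for
the `2 ^ (H - 1 - j)` vertical positions from `y` on. -/
def cellIdx (M H v j y : ℕ) : ℕ := (v * H + j) * M + y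

/-- The pairs of positions to which the cell `i` of the table refers. -/
def Region (M H i px py : ℕ) : Prop :=
  (∃ e, (M + px) / 2 ^ e = i / M / H) ∧ i % M ≤ py ∧ py < i % M + 2 ^ (H - 1 - i / M % H)

theorem cellIdx_decode {M H v j y : ℕ} (hj : j < H) (hy : y < M) :
    cellIdx M H v j y / M / H = v ∧ cellIdx M H v j y / M % H = j ∧ cellIdx M H v j y % M = y := by
  have h1 : cellIdx M H v j y / M = v * H + j := by
    rw [cellIdx, Nat.mul_comm, Nat.mul_add_div (by omega), Nat.div_eq_of_lt hy, add_zero]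
  have h2 : cellIdx M H v j y % M = y := by
    rw [cellIdx, Nat.mul_comm, Nat.mul_add_mod, Nat.mod_eq_of_lt hy]
  refine ⟨?_, ?_, h2⟩
  · rw [h1, Nat.mul_comm, Nat.mul_add_div (by omega), Nat.div_eq_of_lt hj, add_zero]
  · rw [h1, Nat.mul_comm, Nat.mul_add_mod, Nat.mod_eq_of_lt hj]

theorem cellIdx_encode (M H i : ℕ) : cellIdx M H (i / M / H) (i / M % H) (i % M) = i := by
  rw [cellIdx, Nat.div_add_mod', Nat.div_add_mod']

theorem cellIdx_lt {M H V v j y : ℕ} (hv : v < V) (hj : j < H) (hy : y < M) :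
    cellIdx M H v j y < V * H * M := by
  have h1 : v * H + j + 1 ≤ V * H := by
    have := Nat.mul_le_mul_right H (Nat.succ_le_of_lt hv)
    rw [Nat.succ_mul] at this
    omega
  have := Nat.mul_le_mul_right M h1
  rw [Nat.succ_mul] at this
  unfold cellIdx
  omega

theorem region_cellIdx {M H v j y px py : ℕ} (hj : j < H) (hy : y < M) :
    Region M H (cellIdx M H v j y) px py ↔
      (∃ e, (M + px) / 2 ^ e = v) ∧ y ≤ py ∧ py < y + 2 ^ (H - 1 - j) := by
  obtain ⟨h1, h2, h3⟩ := cellIdx_decode (v := v) hj hy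
  rw [Region, h1, h2, h3]

/-- Enter `id` in cell `i` of the table `T` if its key is larger than that of the present entry. -/
noncomputable def chmax (ar : ℕ → ℝ) (T : ℕ → ℕ) (i id : ℕ) : ℕ → ℕ :=
  open Classical in if ar (T i) < ar id then Function.update T i id else T

theorem le_chmax (ar : ℕ → ℝ) (T : ℕ → ℕ) (i id j : ℕ) : ar (T j) ≤ ar (chmax ar T i id j) := by
  unfold chmax
  split_ifs with h
  · by_cases hj : j = i
    · subst hj; simpa using h.le
    · simp [hj]
  · rfl

theorem le_chmax_self (ar : ℕ → ℝ) (T : ℕ → ℕ) (i id : ℕ) : ar id ≤ ar (chmax ar T i id i) := by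
  unfold chmax
  split_ifs with h
  · simp
  · exact not_lt.1 h

theorem chmax_cases (ar : ℕ → ℝ) (T : ℕ → ℕ) (i id j : ℕ) :
    chmax ar T i id j = T j ∨ (j = i ∧ chmax ar T i id j = id) := by
  unfold chmax
  split_ifs
  · by_cases hj : j = i
    · subst hj; simp
    · simp [hj]
  · exact .inl rfl

/-- All boxes entered in the table `T` cover the regions of their cells. -/
def TableSound (M H : ℕ) (fx fy : ℝ → ℕ) (box : ℕ → Box) (T : ℕ → ℕ) : Prop :=
  ∀ i, T i ≠ 0 → ∀ px < M, ∀ py, Region M H i px py → (box (T i)).Covers fx fy px py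

theorem TableSound.chmax {M H : ℕ} {fx fy : ℝ → ℕ} {box : ℕ → Box} {T : ℕ → ℕ}
    (h : TableSound M H fx fy box T) (ar : ℕ → ℝ) {i id : ℕ}
    (hi : id ≠ 0 → ∀ px < M, ∀ py, Region M H i px py → (box id).Covers fx fy px py) :
    TableSound M H fx fy box (chmax ar T i id) := by
  intro j hj
  rcases chmax_cases ar T i id j with e | ⟨rfl, e⟩
  · rw [e] at hj ⊢
    exact h j hj
  · rw [e] at hj ⊢
    exact hi hj

/-- The leaves below a node whose interval at level `e` lies in a given range belong to this
range. -/
theorem mem_range_of_ancestor {M px px₁ px₂ v e e' : ℕ} (h1 : M + px₁ ≤ v * 2 ^ e)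
    (h2 : (v + 1) * 2 ^ e ≤ M + px₂ + 1) (hp₂ : px₂ < M) (hp : px < M)
    (h : (M + px) / 2 ^ e' = v) : px₁ ≤ px ∧ px ≤ px₂ := by
  have hpos : 0 < 2 ^ e' := by positivity
  have ha : v * 2 ^ e' ≤ M + px := by rw [← h]; exact Nat.div_mul_le_self _ _
  have hb : M + px < (v + 1) * 2 ^ e' := by
    rw [← h, Nat.mul_comm]; exact Nat.lt_mul_div_succ _ hpos
  -- `M` need not be a power of two, so the levels `e` and `e'` could differ a priori. Leaves have
  -- numbers in `[M, 2M)`: a larger `e'` would give a number of at least `2M`, a smaller one a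
  -- number below `M`. Only equality survives.
  rcases lt_trichotomy e e' with hlt | rfl | hlt
  · have : 2 ^ (e + 1) ≤ 2 ^ e' := Nat.pow_le_pow_right (by norm_num) hlt
    have h3 := Nat.mul_le_mul_left v this
    rw [pow_succ] at h3
    have : v * (2 ^ e * 2) = 2 * (v * 2 ^ e) := by ring
    omega
  · omega
  · have : 2 ^ (e' + 1) ≤ 2 ^ e := Nat.pow_le_pow_right (by norm_num) hlt
    have h3 := Nat.mul_le_mul_left (v + 1) this
    rw [pow_succ] at h3
    have : (v + 1) * (2 ^ e' * 2) = 2 * ((v + 1) * 2 ^ e') := by ring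
    omega

/-- The entry of cell `i` is at least as good as those of the cells whose regions contain the
region of cell `i`. -/
structure Pulled (M H : ℕ) (val : ℕ → ℝ) (i : ℕ) : Prop where
  up : 0 < i / M % H → val (i - M) ≤ val i
  shift : 0 < i / M % H → 2 ^ (H - 1 - i / M % H) ≤ i % M →
    val (i - M - 2 ^ (H - 1 - i / M % H)) ≤ val i
  parent : val (cellIdx M H (i / M / H / 2) (i / M % H) (i % M)) ≤ val i

theorem pulled_cellIdx {M H : ℕ} {val : ℕ → ℝ} {v j y : ℕ} (hj : j < H) (hy : y < M) :
    Pulled M H val (cellIdx M H v j y) ↔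
      (0 < j → val (cellIdx M H v (j - 1) y) ≤ val (cellIdx M H v j y)) ∧
      (0 < j → 2 ^ (H - 1 - j) ≤ y →
        val (cellIdx M H v (j - 1) (y - 2 ^ (H - 1 - j))) ≤ val (cellIdx M H v j y)) ∧
      val (cellIdx M H (v / 2) j y) ≤ val (cellIdx M H v j y) := by
  obtain ⟨h1, h2, h3⟩ := cellIdx_decode (v := v) hj hy
  have e1 : 0 < j → cellIdx M H v j y - M = cellIdx M H v (j - 1) y := by
    intro h
    obtain ⟨j, rfl⟩ : ∃ j', j = j' + 1 := ⟨j - 1, by omega⟩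
    simp only [cellIdx, Nat.add_sub_cancel]
    rw [← add_assoc, Nat.succ_mul]
    omega
  have e2 : ∀ w ≤ y, ∀ j, cellIdx M H v j y - w = cellIdx M H v j (y - w) := by
    intro w hw j
    unfold cellIdx
    omega
  constructor
  · rintro ⟨ha, hb, hc⟩
    rw [h2] at ha hb
    rw [h1, h2, h3] at hc
    rw [h3] at hb
    refine ⟨fun h => e1 h ▸ ha h, fun h hw => ?_, hc⟩
    have := hb h hw
    rwa [e1 h, e2 _ hw] at this
  · rintro ⟨ha, hb, hc⟩
    refine ⟨?_, ?_, ?_⟩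
    · rw [h2]
      intro h
      rw [e1 h]
      exact ha h
    · rw [h2, h3]
      intro h hw
      rw [e1 h, e2 _ hw]
      exact hb h hw
    · rw [h1, h2, h3]
      exact hc

/-- Starting from any cell whose region contains the pair, `hV` halves the range of rows towards
`py` within one node until a single row is left, and `hE` then descends the tree to the leaf. Every
move is one of the inequalities in `Pulled`. -/
theorem val_le_leaf {M H : ℕ} {val : ℕ → ℝ} (hp : ∀ i < 2 * M * H * M, Pulled M H val i)
    {i px py : ℕ} (hi : i < 2 * M * H * M) (hpx : px < M) (hpy : py < M)
    (hr : Region M H i px py) : val i ≤ val (cellIdx M H (M + px) (H - 1) py) := by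
  have hH : 0 < H := by
    rcases Nat.eq_zero_or_pos H with rfl | h
    · simp at hi
    · exact h
  have hM : 0 < M := by omega
  have hv : ∀ e, (M + px) / 2 ^ e < 2 * M := fun e =>
    (Nat.div_le_self _ _).trans_lt (by omega)
  have hV : ∀ e v, v = (M + px) / 2 ^ e → ∀ k < H, ∀ y, y ≤ py → py < y + 2 ^ k →
      val (cellIdx M H v (H - 1 - k) y) ≤ val (cellIdx M H v (H - 1) py) := by
    rintro e v rfl k
    induction k with
    | zero =>
      intro _ y h1 h2
      obtain rfl : y = py := by simp at h2; omega
      exact le_rfl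
    | succ k ih =>
      intro hk y h1 h2
      have hyM : y < M := by omega
      have hkk : H - 1 - (H - 1 - k) = k := by omega
      have hj : H - 1 - k - 1 = H - 1 - (k + 1) := by omega
      -- The lower half starts at the same row and uses `up`; the upper half starts `2 ^ k` rows
      -- higher and uses `shift`.
      by_cases hc : py < y + 2 ^ k
      · have := ((pulled_cellIdx (by omega) hyM).1 (hp _ (cellIdx_lt (v := (M + px) / 2 ^ e)
          (j := H - 1 - k) (hv e) (by omega) hyM))).1 (by omega)
        rw [hj] at this
        exact this.trans (ih (by omega) y h1 hc)
      · rw [pow_succ] at h2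
        have hyM' : y + 2 ^ k < M := by omega
        have := ((pulled_cellIdx (by omega) hyM').1 (hp _ (cellIdx_lt (v := (M + px) / 2 ^ e)
          (j := H - 1 - k) (hv e) (by omega) hyM'))).2.1 (by omega) (by rw [hkk]; omega)
        rw [hj, hkk, Nat.add_sub_cancel] at this
        exact this.trans (ih (by omega) _ (by omega) (by omega))
  have hE : ∀ e, val (cellIdx M H ((M + px) / 2 ^ e) (H - 1) py) ≤
      val (cellIdx M H (M + px) (H - 1) py) := by
    intro e
    induction e with
    | zero => simp
    | succ e ih =>
      have := ((pulled_cellIdx (by omega) hpy).1 (hp _ (cellIdx_lt (v := (M + px) / 2 ^ e)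
        (j := H - 1) (hv e) (by omega) hpy))).2.2
      rw [Nat.div_div_eq_div_mul, ← pow_succ] at this
      exact this.trans ih
  obtain ⟨⟨e, he⟩, h1, h2⟩ := hr
  have hj : i / M % H < H := Nat.mod_lt _ hH
  have := hV e _ rfl (H - 1 - i / M % H) (by omega) (i % M) h1 h2
  rw [show H - 1 - (H - 1 - i / M % H) = i / M % H by omega, he, cellIdx_encode, ← he] at this
  exact this.trans (hE e)

namespace RealRAM

/-! ## Binary search -/

/-- Compute in integer register 10 the position of the value in real register 10 relative to the
first `N` entries of the sorted real array `a`, where integer register 1 holds `N`. -/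
def locate (a : ℕ) : Cmd :=
  .seq (.seq (.setInt 10 (.const 0)) (.setInt 11 (.reg 1))) <|
  .seq (.while (.intLt (.reg 10) (.reg 11)) <|
    .seq (.setInt 12 (.div (.add (.reg 10) (.reg 11)) (.const 2))) <|
    .ite (.realLt (.load a (.reg 12)) (.reg 10))
      (.setInt 10 (.add (.reg 12) (.const 1)))
      (.setInt 11 (.reg 12))) <|
  .ite (.and (.intLt (.reg 10) (.reg 1)) (.realEq (.load a (.reg 10)) (.reg 10)))
    (.setInt 10 (.add (.mul (.const 2) (.reg 10)) (.const 1)))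
    (.setInt 10 (.mul (.const 2) (.reg 10)))

/-- Binary search with invariant: entries before `lo` are smaller than `v`, entries from `hi` on are
not. The length `hi - lo` stays below a power of two whose exponent drops each round, which bounds
the rounds by `H`. -/
theorem locate_runs {S a N H : ℕ} {s : State} {Z : ℕ → ℝ} (hN : s.intReg 1 = N)
    (hZ : s.mem.reals a = Z) (hmono : ∀ i j, i ≤ j → j < N → Z i ≤ Z j) (hNH : N < 2 ^ H)
    (hS : 2 * N + 1 < S) :
    Runs S (locate a) s (19 * H + 30) (fun s' => s'.intReg 10 = gridPos Z N (s.realReg 10)) := by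
  set v := s.realReg 10 with hv
  have h1 : Runs S (.seq (.setInt 10 (.const 0)) (.setInt 11 (.reg 1))) s 4
      (fun s' => s'.intReg 10 = 0 ∧ s'.intReg 11 = N) :=
    (Runs.of_wp (by simp [hN]; omega)).mono (by decide) fun _ _ h => h
  refine (Runs.seq' h1 (T' := 19 * H + 26) ?_).mono (by omega) fun _ _ h => h
  rintro s1 f1 ⟨h10, h11⟩
  have hv1 : s1.realReg 10 = v := f1.real 10 rfl
  have hN1 : s1.intReg 1 = N := (f1.int 1 rfl).trans hN
  have hZ1 : s1.mem.reals a = Z := (f1.reals a rfl).trans hZ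
  refine (Runs.seq' (T := 19 * H + 4) (T' := 16)
    (P := fun s' => ∃ lo, s'.intReg 10 = lo ∧ lo ≤ N ∧ (∀ i < lo, Z i < v) ∧
      ∀ i, lo ≤ i → i < N → v ≤ Z i) ?_ ?_).mono (by omega) fun _ _ h => h
  · refine (Runs.whileLoop (T := 15) (fun m s' => ∃ lo hi, s'.intReg 10 = lo ∧ s'.intReg 11 = hi ∧
      lo ≤ hi ∧ hi ≤ N ∧ (∀ i < lo, Z i < v) ∧ (∀ i, hi ≤ i → i < N → v ≤ Z i) ∧
      hi - lo < 2 ^ m) H s1 ⟨0, N, h10, h11, by omega, le_rfl, by simp, by omega, by simpa⟩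
      ?_).mono (by simp only [Test.cost, IntExpr.cost]; omega) fun _ _ h => h
    rintro m s2 f2 ⟨lo, hi, e10, e11, hlh, hhN, hlo, hhi, hm⟩
    have hv2 : s2.realReg 10 = v := (f2.real 10 rfl).trans hv1
    have hZ2 : s2.mem.reals a = Z := (f2.reals a rfl).trans hZ1
    refine ⟨⟨trivial, trivial⟩, fun hb => ?_, fun hb => ?_⟩
    · simp only [Test.Holds, IntExpr.eval, e10, e11] at hb
      obtain ⟨m, rfl⟩ : ∃ m', m = m' + 1 := by
        rcases m with _ | m
        · simp at hm; omega
        · exact ⟨m, rfl⟩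
      refine ⟨m, rfl, (Runs.of_wp ?_).mono (by simp [Cmd.maxCost, Test.cost, IntExpr.cost,
        RealExpr.cost]) fun _ _ h => h⟩
      rw [pow_succ] at hm
      have hmid : (lo + hi) / 2 < hi := by omega
      have hmid' : lo ≤ (lo + hi) / 2 := by omega
      simp [e10, e11, hv2, hZ2]
      refine ⟨by omega, fun h => ⟨by omega, by omega, hhN, ?_, hhi,
        by omega⟩, fun h => ⟨by omega, hmid', by omega, hlo, ?_, by omega⟩⟩
      · intro i hi'
        exact (hmono i _ hi' (by omega)).trans_lt h
      · intro i hi' hiN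
        exact h.trans (hmono _ _ hi' hiN)
    · simp only [Test.Holds, IntExpr.eval, e10, e11] at hb
      obtain rfl : lo = hi := by omega
      exact ⟨lo, e10, hhN, hlo, hhi⟩
  · rintro s2 f2 ⟨lo, e10, hlN, hlo, hhi⟩
    have hv2 : s2.realReg 10 = v := (f2.real 10 rfl).trans hv1
    have hZ2 : s2.mem.reals a = Z := (f2.reals a rfl).trans hZ1
    have hN2 : s2.intReg 1 = N := (f2.int 1 rfl).trans hN1
    classical
    refine (Runs.of_wp ?_).mono (by simp [Cmd.maxCost, Test.cost, IntExpr.cost,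
        RealExpr.cost]) fun _ _ h => h
    rw [gridPos_eq hmono hlN hlo hhi]
    simp only [wp, Test.Legal, Test.Holds, IntExpr.eval, RealExpr.eval, IntExpr.Legal,
      RealExpr.Legal, e10, hv2, hZ2, hN2, State.setInt_intReg, if_true, and_self, true_and]
    refine ⟨fun _ => ⟨by omega, trivial⟩, fun h => ⟨by omega, by simp [h]⟩, fun h => ⟨by omega, by
      rw [if_neg h]; rfl⟩⟩

/-! ## Entering boxes in the table -/

/-- Replace the integer array 0. -/
def State.setTable (s : State) (T : ℕ → ℕ) : State :=
  { s with mem := { s.mem with ints := Function.update s.mem.ints 0 T } }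

theorem State.setTable_ints (s : State) (T : ℕ → ℕ) (a : ℕ) :
    (s.setTable T).mem.ints a = if a = 0 then T else s.mem.ints a := by
  simp [State.setTable, Function.update_apply]

theorem State.setTable_intReg (s : State) (T : ℕ → ℕ) : (s.setTable T).intReg = s.intReg := rfl

theorem State.setTable_realReg (s : State) (T : ℕ → ℕ) : (s.setTable T).realReg = s.realReg := rfl

theorem State.setTable_reals (s : State) (T : ℕ → ℕ) :
    (s.setTable T).mem.reals = s.mem.reals := rfl

theorem State.setTable_setTable (s : State) (T T' : ℕ → ℕ) :
    (s.setTable T).setTable T' = s.setTable T' := by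
  simp [State.setTable]

attribute [simp] State.setTable_ints State.setTable_intReg State.setTable_realReg
  State.setTable_reals State.setTable_setTable

/-- Enter the box number in integer register `r` in the cell `i` of the table, if it has larger
area than the present entry. -/
def chmaxCmd (i : IntExpr) (r : ℕ) : Cmd :=
  .ite (.realLt (.load 8 (.load 0 i)) (.load 8 (.reg r))) (.storeInt 0 i (.reg r)) .skip

theorem chmaxCmd_runs {S : ℕ} {i : IntExpr} {r : ℕ} {s : State} (hi : i.Legal S s)
    (hiS : i.eval s < S) (hT : s.mem.ints 0 (i.eval s) < S) (hr : s.intReg r < S) :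
    Runs S (chmaxCmd i r) s (2 * i.cost + 9) (fun s' => s' =
      s.setTable (chmax (s.mem.reals 8) (s.mem.ints 0) (i.eval s) (s.intReg r))) := by
  refine (Runs.of_wp ?_).mono ?_ fun _ _ h => h
  · simp only [chmaxCmd, wp, Test.Legal, RealExpr.Legal, IntExpr.Legal, Test.Holds, RealExpr.eval,
      IntExpr.eval]
    refine ⟨⟨⟨⟨hi, hiS⟩, hT⟩, trivial, hr⟩, fun h => ⟨hi, hiS, trivial, hr, ?_⟩, fun h => ?_⟩
    · simp [chmax, h, State.storeInt, State.setTable]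
    · simp [chmax, h, State.setTable]
  · simp only [chmaxCmd, Cmd.maxCost, Test.cost, RealExpr.cost, IntExpr.cost]
    omega

/-- The expression for an index of the table; integer registers 2 and 3 hold its dimensions. -/
def cellExpr (v j y : IntExpr) : IntExpr :=
  .add (.mul (.add (.mul v (.reg 3)) j) (.reg 2)) y

/-- Enter the box number in register 4 in all cells for nodes of the segment tree that make up
the range of leaves from register 25 to register 26, and for the rows in registers 22 and 28. -/
def insertLoop : Cmd :=
  .while (.not (.intLt (.reg 26) (.reg 25))) <|
    .seq (chmaxCmd (cellExpr (.reg 25) (.reg 27) (.reg 22)) 4) <|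
    .seq (chmaxCmd (cellExpr (.reg 25) (.reg 27) (.reg 28)) 4) <|
    .seq (chmaxCmd (cellExpr (.reg 26) (.reg 27) (.reg 22)) 4) <|
    .seq (chmaxCmd (cellExpr (.reg 26) (.reg 27) (.reg 28)) 4) <|
    .seq (.setInt 25 (.div (.add (.reg 25) (.const 1)) (.const 2)))
      (.setInt 26 (.div (.sub (.reg 26) (.const 1)) (.const 2)))

/-- Bottom-up traversal of the segment tree. At height `e` the nodes `l` to `r` stand for leaves
inside the given range, and each leaf of the range either has its ancestor among these nodes or is
already served. Both end nodes are entered without a parity test, which is harmless since their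
leaves belong to the range. The number of nodes at least halves per round. -/
theorem insertLoop_runs {S M H id y₁ y₂ j px₁ px₂ : ℕ} {s : State} {box : ℕ → Box}
    {fx fy : ℝ → ℕ} {T : ℕ → ℕ} {ar : ℕ → ℝ}
    (h2 : s.intReg 2 = M) (h3 : s.intReg 3 = H) (h4 : s.intReg 4 = id)
    (h22 : s.intReg 22 = y₁) (h27 : s.intReg 27 = j) (h28 : s.intReg 28 = y₂)
    (h25 : s.intReg 25 = M + px₁) (h26 : s.intReg 26 = M + px₂) (hM : M < 2 ^ H)
    (hS : 2 * M * H * M < S) (hMS : 2 * M < S) (hp : px₂ < M) (hj : j < H) (hy : y₁ ≤ y₂)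
    (hy₂ : y₂ < M) (hid : id < S) (hT : s.mem.ints 0 = T) (har : s.mem.reals 8 = ar)
    (hTid : ∀ i, T i ≤ id) (hsound : TableSound M H fx fy box T)
    (hcov : ∀ px py, px₁ ≤ px → px ≤ px₂ → y₁ ≤ py → py < y₂ + 2 ^ (H - 1 - j) →
      (box id).Covers fx fy px py) :
    Runs S insertLoop s (125 * H + 6) (fun s' => (∀ i, s'.mem.ints 0 i ≤ id) ∧
      TableSound M H fx fy box (s'.mem.ints 0) ∧ (∀ i, ar (T i) ≤ ar (s'.mem.ints 0 i)) ∧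
      ∀ px, px₁ ≤ px → px ≤ px₂ → ∃ v < 2 * M, (∃ e, (M + px) / 2 ^ e = v) ∧
        ar id ≤ ar (s'.mem.ints 0 (cellIdx M H v j y₁)) ∧
        ar id ≤ ar (s'.mem.ints 0 (cellIdx M H v j y₂))) := by
  refine (Runs.whileLoop (T := 120) (fun m s' => ∃ e l r T', s'.intReg 25 = l ∧
      s'.intReg 26 = r ∧ s'.mem.ints 0 = T' ∧ 0 < l ∧ r < 2 * M ∧ M + px₁ ≤ l * 2 ^ e ∧
      (r + 1) * 2 ^ e ≤ M + px₂ + 1 ∧ r + 1 - l < 2 ^ m ∧ (∀ i, T' i ≤ id) ∧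
      TableSound M H fx fy box T' ∧ (∀ i, ar (T i) ≤ ar (T' i)) ∧
      ∀ px, px₁ ≤ px → px ≤ px₂ → (l ≤ (M + px) / 2 ^ e ∧ (M + px) / 2 ^ e ≤ r) ∨
        ∃ v < 2 * M, (∃ e, (M + px) / 2 ^ e = v) ∧ ar id ≤ ar (T' (cellIdx M H v j y₁)) ∧
        ar id ≤ ar (T' (cellIdx M H v j y₂))) H s
      ⟨0, M + px₁, M + px₂, T, h25, h26, hT, by omega, by omega, by simp, by simp, by omega,
        hTid, hsound, fun _ => le_rfl, fun px ha hb => .inl (by simp [ha, hb])⟩ ?_).mono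
      (by simp only [Test.cost, IntExpr.cost]; omega) fun _ _ h => h
  rintro m s' f ⟨e, l, r, T', e25, e26, eT, hl, hr, hle, hre, hm, hTid', hs', hmono, hdone⟩
  have e2 : s'.intReg 2 = M := (f.int 2 rfl).trans h2
  have e3 : s'.intReg 3 = H := (f.int 3 rfl).trans h3
  have e4 : s'.intReg 4 = id := (f.int 4 rfl).trans h4
  have e22 : s'.intReg 22 = y₁ := (f.int 22 rfl).trans h22
  have e27 : s'.intReg 27 = j := (f.int 27 rfl).trans h27
  have e28 : s'.intReg 28 = y₂ := (f.int 28 rfl).trans h28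
  have ear : s'.mem.reals 8 = ar := (f.reals 8 rfl).trans har
  have hy₁ : y₁ < M := by omega
  refine ⟨⟨trivial, trivial⟩, fun hb => ?_, fun hb => ?_⟩
  · simp only [Test.Holds, IntExpr.eval, e25, e26, not_lt] at hb
    obtain ⟨m, rfl⟩ : ∃ m', m = m' + 1 := by
      rcases m with _ | m
      · simp at hm; omega
      · exact ⟨m, rfl⟩
    refine ⟨m, rfl, ?_⟩
    set T₁ := chmax ar T' (cellIdx M H l j y₁) id with hT₁
    set T₂ := chmax ar T₁ (cellIdx M H l j y₂) id with hT₂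
    set T₃ := chmax ar T₂ (cellIdx M H r j y₁) id with hT₃
    set T₄ := chmax ar T₃ (cellIdx M H r j y₂) id with hT₄
    have hle_id : ∀ T' : ℕ → ℕ, ∀ i, (∀ i, T' i ≤ id) → ∀ k, chmax ar T' i id k ≤ id := by
      intro T' i h k
      rcases chmax_cases ar T' i id k with h' | ⟨-, h'⟩ <;> rw [h']
      exact h k
    have i1 := hle_id _ (cellIdx M H l j y₁) hTid'
    have i2 := hle_id _ (cellIdx M H l j y₂) i1
    have i3 := hle_id _ (cellIdx M H r j y₁) i2
    have i4 := hle_id _ (cellIdx M H r j y₂) i3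
    have hcell : ∀ v y, v < 2 * M → y < M → cellIdx M H v j y < S := fun v y hv hy =>
      (cellIdx_lt hv hj hy).trans hS
    have hch : ∀ (s₀ : State) (T₀ : ℕ → ℕ) (a b v y : ℕ), s₀ = s'.setTable T₀ →
        (∀ i, T₀ i ≤ id) → s'.intReg a = v → s'.intReg b = y → v < 2 * M → y < M →
        Runs S (chmaxCmd (cellExpr (.reg a) (.reg 27) (.reg b)) 4) s₀ 27 (fun s'' =>
          s'' = s'.setTable (chmax ar T₀ (cellIdx M H v j y) id)) := by
      rintro s₀ T₀ a b v y rfl hT₀ rfl rfl hv hy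
      have := hcell _ _ hv hy
      unfold cellIdx at this
      refine (chmaxCmd_runs (by simp [cellExpr]) ?_ ?_ ?_).mono ?_ ?_
      · simpa [cellExpr, e2, e3, e27] using this
      · simpa using (hT₀ _).trans_lt hid
      · simpa [e4] using hid
      · simp [cellExpr, IntExpr.cost]
      · rintro s'' - rfl
        simp [cellExpr, cellIdx, e2, e3, e4, e27, ear]
    have hs0 : s' = s'.setTable T' := by
      rw [← eT]; simp [State.setTable]
    refine (Runs.seq' (hch s' T' 25 22 l y₁ hs0 hTid' e25 e22 (by omega) hy₁) (T' := 93)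
      ?_).mono le_rfl fun _ _ h => h
    rintro s1 - hs1
    refine (Runs.seq' (hch s1 T₁ 25 28 l y₂ hs1 i1 e25 e28 (by omega) hy₂) (T' := 66)
      ?_).mono le_rfl fun _ _ h => h
    rintro s2 - hs2
    refine (Runs.seq' (hch s2 T₂ 26 22 r y₁ hs2 i2 e26 e22 hr hy₁) (T' := 39)
      ?_).mono le_rfl fun _ _ h => h
    rintro s3 - hs3
    refine (Runs.seq' (hch s3 T₃ 26 28 r y₂ hs3 i3 e26 e28 hr hy₂) (T' := 12)
      ?_).mono le_rfl fun _ _ h => h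
    rintro s4 - rfl
    refine (Runs.of_wp ?_).mono (by simp [Cmd.maxCost, IntExpr.cost]) fun _ _ h => h
    simp only [wp, IntExpr.Legal, IntExpr.eval, State.setTable_intReg, e25, State.setInt_intReg,
      State.setInt_mem, State.setTable_ints]
    simp only [e26, Nat.reduceEqDiff, if_false, if_true, and_self, true_and, ne_eq,
      OfNat.ofNat_ne_zero, not_false_eq_true, exists_and_left, ← hT₄]
    have hanc : ∀ v px py e' y, l ≤ v → v ≤ r → px < M → (M + px) / 2 ^ e' = v →
        y₁ ≤ y → y ≤ y₂ → y ≤ py → py < y + 2 ^ (H - 1 - j) → (box id).Covers fx fy px py := by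
      intro v px py e' y hv hv' hpx he hya hyb h1 h2
      obtain ⟨ha, hb⟩ := mem_range_of_ancestor (e := e)
        (hle.trans (Nat.mul_le_mul_right _ hv))
        ((Nat.mul_le_mul_right _ (Nat.succ_le_succ hv')).trans hre) hp hpx he
      exact hcov px py ha hb (by omega) (by omega)
    have hsnd : ∀ v y, l ≤ v → v ≤ r → y₁ ≤ y → y ≤ y₂ → ∀ px < M, ∀ py,
        Region M H (cellIdx M H v j y) px py → (box id).Covers fx fy px py := by
      intro v y hv hv' hya hyb px hpx py hreg
      rw [region_cellIdx hj (by omega)] at hreg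
      obtain ⟨⟨e', he⟩, h1, h2⟩ := hreg
      exact hanc v px py e' y hv hv' hpx he hya hyb h1 h2
    have m1 := le_chmax ar T' (cellIdx M H l j y₁) id
    have m2 := le_chmax ar T₁ (cellIdx M H l j y₂) id
    have m3 := le_chmax ar T₂ (cellIdx M H r j y₁) id
    have m4 := le_chmax ar T₃ (cellIdx M H r j y₂) id
    rw [← hT₁] at m1
    rw [← hT₂] at m2
    rw [← hT₃] at m3
    rw [← hT₄] at m4
    have c1 := le_chmax_self ar T' (cellIdx M H l j y₁) id
    have c2 := le_chmax_self ar T₁ (cellIdx M H l j y₂) id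
    have c3 := le_chmax_self ar T₂ (cellIdx M H r j y₁) id
    have c4 := le_chmax_self ar T₃ (cellIdx M H r j y₂) id
    rw [← hT₁] at c1
    rw [← hT₂] at c2
    rw [← hT₃] at c3
    rw [← hT₄] at c4
    refine ⟨by omega, by omega, e + 1, _, rfl, _, rfl, _, rfl, by omega, by omega, ?_, ?_, ?_, i4,
      ?_, fun i => (hmono i).trans ((m1 i).trans ((m2 i).trans ((m3 i).trans (m4 i)))), ?_⟩
    · refine hle.trans ?_
      rw [pow_succ, ← mul_assoc, mul_right_comm]
      exact Nat.mul_le_mul_right _ (by omega)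
    · refine le_trans ?_ hre
      rw [pow_succ, ← mul_assoc, mul_right_comm]
      exact Nat.mul_le_mul_right _ (by omega)
    · rw [pow_succ] at hm
      omega
    · exact (((hs'.chmax ar fun _ => hsnd l y₁ le_rfl hb le_rfl hy).chmax ar
        fun _ => hsnd l y₂ le_rfl hb hy le_rfl).chmax ar
        fun _ => hsnd r y₁ hb le_rfl le_rfl hy).chmax ar fun _ => hsnd r y₂ hb le_rfl hy le_rfl
    · intro px ha hb'
      rcases hdone px ha hb' with ⟨q1, q2⟩ | ⟨v, hv, hv', q1, q2⟩
      -- An ancestor equal to an end node has just been served. Any other lies strictly inside, and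
      -- its parent is between the new ends.
      · rcases eq_or_ne ((M + px) / 2 ^ e) l with hq | hq
        · exact .inr ⟨l, by omega, ⟨e, hq⟩,
            c1.trans ((m2 _).trans ((m3 _).trans (m4 _))), c2.trans ((m3 _).trans (m4 _))⟩
        rcases eq_or_ne ((M + px) / 2 ^ e) r with hq' | hq'
        · exact .inr ⟨r, by omega, ⟨e, hq'⟩, c3.trans (m4 _), c4⟩
        · left
          rw [pow_succ, ← Nat.div_div_eq_div_mul]
          omega
      · exact .inr ⟨v, hv, hv', q1.trans ((m1 _).trans ((m2 _).trans ((m3 _).trans (m4 _)))),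
          q2.trans ((m1 _).trans ((m2 _).trans ((m3 _).trans (m4 _))))⟩
  · simp only [Test.Holds, IntExpr.eval, e25, e26, not_not] at hb
    rw [eT]
    refine ⟨hTid', hs', hmono, fun px ha hb' => ?_⟩
    rcases hdone px ha hb' with ⟨q1, q2⟩ | h
    · omega
    · exact h

/-- Enter box number (register 4) with horizontal positions in registers 20 and 21 and vertical
positions in registers 22 and 23. -/
def insert : Cmd :=
  .seq (.seq (.setInt 29 (.sub (.add (.reg 23) (.const 1)) (.reg 22))) (.setInt 24 (.const 0))) <|
  .seq (.while (.not (.intLt (.reg 29) (.mul (.const 2) (.load 1 (.reg 24)))))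
    (.setInt 24 (.add (.reg 24) (.const 1)))) <|
  .seq (.seq (.setInt 27 (.sub (.sub (.reg 3) (.const 1)) (.reg 24))) <|
    .seq (.setInt 28 (.sub (.add (.reg 23) (.const 1)) (.load 1 (.reg 24)))) <|
    .seq (.setInt 25 (.add (.reg 2) (.reg 20)))
      (.setInt 26 (.add (.reg 2) (.reg 21))))
  insertLoop

/-- Sizes of the data structure: `N` grid points, `M` positions in each direction and `H` levels
fit into the memory bound `S`. -/
structure Sizes (S N M H : ℕ) : Prop where
  hN : 2 ≤ N
  hM : M = 2 * N
  hH : 0 < H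
  pow_le : 2 ^ (H - 1) ≤ M
  lt_pow : M < 2 ^ H
  lt_S : 2 * M * H * M < S

theorem Sizes.two_le_H {S N M H : ℕ} (z : Sizes S N M H) : 2 ≤ H := by
  by_contra h
  have h1 : H ≤ 1 := by omega
  have := z.lt_pow
  have h2 : 2 ^ H ≤ 2 ^ 1 := Nat.pow_le_pow_right (by norm_num) h1
  have := z.hM
  have := z.hN
  omega

/-- Provides the room for box numbers, of which at most `2 * N ^ 2` will be used. -/
theorem Sizes.sq_lt {S N M H : ℕ} (z : Sizes S N M H) : 4 * (M * M) < S := by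
  refine lt_of_le_of_lt ?_ z.lt_S
  have := Nat.mul_le_mul_left (2 * M * M) z.two_le_H
  calc 4 * (M * M) = 2 * M * M * 2 := by ring
    _ ≤ 2 * M * M * H := this
    _ = 2 * M * H * M := by ring

theorem Sizes.four_mul_lt {S N M H : ℕ} (z : Sizes S N M H) : 4 * M < S := by
  have h := z.sq_lt
  have := Nat.mul_le_mul_left M (show 1 ≤ M by have := z.hN; have := z.hM; omega)
  omega

theorem Sizes.H_lt {S N M H : ℕ} (z : Sizes S N M H) : H < S := by
  have h := z.four_mul_lt
  have h1 := z.pow_le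
  have h2 : H - 1 < 2 ^ (H - 1) := Nat.lt_two_pow_self
  omega

/-- The rows form the union of two ranges of length `2 ^ k`, one at each end, where `2 ^ k` is the
largest power of two not exceeding the number of rows. Overlap is harmless for maxima, so two rows
of cells per node suffice. -/
theorem insert_runs {S N M H id px₁ px₂ py₁ py₂ : ℕ} {s : State} {box : ℕ → Box} {fx fy : ℝ → ℕ}
    {T : ℕ → ℕ} {ar : ℕ → ℝ} (z : Sizes S N M H)
    (h2 : s.intReg 2 = M) (h3 : s.intReg 3 = H) (h4 : s.intReg 4 = id)
    (h20 : s.intReg 20 = px₁) (h21 : s.intReg 21 = px₂) (h22 : s.intReg 22 = py₁)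
    (h23 : s.intReg 23 = py₂) (hpw : ∀ k < H, s.mem.ints 1 k = 2 ^ k)
    (hpx₁ : px₁ < M) (hpx₂ : px₂ < M) (hpy : py₁ ≤ py₂) (hpy₂ : py₂ < M) (hid : id < S)
    (hT : s.mem.ints 0 = T) (har : s.mem.reals 8 = ar) (hTid : ∀ i, T i ≤ id)
    (hsound : TableSound M H fx fy box T)
    (hcov : ∀ px py, px₁ ≤ px → px ≤ px₂ → py₁ ≤ py → py ≤ py₂ → (box id).Covers fx fy px py) :
    Runs S insert s (150 * H + 100) (fun s' => (∀ i, s'.mem.ints 0 i ≤ id) ∧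
      TableSound M H fx fy box (s'.mem.ints 0) ∧ (∀ i, ar (T i) ≤ ar (s'.mem.ints 0 i)) ∧
      ∀ px py, px₁ ≤ px → px ≤ px₂ → py₁ ≤ py → py ≤ py₂ →
        ∃ i < 2 * M * H * M, Region M H i px py ∧ ar id ≤ ar (s'.mem.ints 0 i)) := by
  have hMS := z.four_mul_lt
  have hHS := z.H_lt
  have hHpos := z.hH
  have hltp := z.lt_pow
  have a1 : Runs S (.seq (.setInt 29 (.sub (.add (.reg 23) (.const 1)) (.reg 22)))
      (.setInt 24 (.const 0))) s 8
      (fun s' => s'.intReg 29 = py₂ + 1 - py₁ ∧ s'.intReg 24 = 0) :=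
    (Runs.of_wp (by simp [h22, h23]; omega)).mono (by decide) fun _ _ h => h
  refine (Runs.seq' a1 (T' := 150 * H + 90) ?_).mono (by omega) fun _ _ h => h
  rintro s1 f1 ⟨e29, e24⟩
  have a2 : Runs S (.while (.not (.intLt (.reg 29) (.mul (.const 2) (.load 1 (.reg 24)))))
      (.setInt 24 (.add (.reg 24) (.const 1)))) s1 (13 * H + 9) (fun s' => ∃ k < H,
      s'.intReg 24 = k ∧ 2 ^ k ≤ py₂ + 1 - py₁ ∧ py₂ + 1 - py₁ < 2 * 2 ^ k) := by
    refine (Runs.whileLoop (T := 4) (fun m s' => ∃ k < H, m + k = H ∧ s'.intReg 24 = k ∧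
      2 ^ k ≤ py₂ + 1 - py₁) H s1 ⟨0, hHpos, by simp, e24, by simp; omega⟩ ?_).mono
      (by simp only [Test.cost, IntExpr.cost]; omega) fun _ _ h => h
    rintro m s' f ⟨k, hk, hmk, e24', hle⟩
    have e29' : s'.intReg 29 = py₂ + 1 - py₁ := (f.int 29 rfl).trans e29
    have hpw' : s'.mem.ints 1 k = 2 ^ k := by
      rw [f.ints 1 rfl, f1.ints 1 rfl, hpw k hk]
    refine ⟨by simp [e24']; omega, fun hb => ?_, fun hb => ?_⟩
    · simp only [Test.Holds, IntExpr.eval, e29', e24', hpw', not_lt] at hb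
      -- The search stops inside the list of powers, since the number of rows is at most `M < 2 ^
      -- H`.
      have hk' : k + 1 < H := by
        by_contra h
        have : H = k + 1 := by omega
        rw [this, pow_succ] at hltp
        omega
      refine ⟨m - 1, by omega, (Runs.of_wp ?_).mono (by decide) fun _ _ h => h⟩
      simp only [wp, IntExpr.Legal, IntExpr.eval, e24', State.setInt_intReg]
      refine ⟨by simp, by omega, k + 1, hk', by omega, by simp, by rw [pow_succ]; omega⟩
    · simp only [Test.Holds, IntExpr.eval, e29', e24', hpw', not_not] at hb
      exact ⟨k, hk, e24', hle, hb⟩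
  refine (Runs.seq' a2 (T' := 150 * H + 90 - (13 * H + 9)) ?_).mono (by omega) fun _ _ h => h
  rintro s2 f2 ⟨k, hk, e24', hle, hlt⟩
  have hpw2 : s2.mem.ints 1 k = 2 ^ k := by rw [f2.ints 1 rfl, f1.ints 1 rfl, hpw k hk]
  have g2 : s2.intReg 2 = M := by rw [f2.int 2 rfl, f1.int 2 rfl, h2]
  have g3 : s2.intReg 3 = H := by rw [f2.int 3 rfl, f1.int 3 rfl, h3]
  have g20 : s2.intReg 20 = px₁ := by rw [f2.int 20 rfl, f1.int 20 rfl, h20]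
  have g21 : s2.intReg 21 = px₂ := by rw [f2.int 21 rfl, f1.int 21 rfl, h21]
  have g23 : s2.intReg 23 = py₂ := by rw [f2.int 23 rfl, f1.int 23 rfl, h23]
  refine (Runs.seq' (T := 30) (T' := 125 * H + 6) (P := fun s' => s'.intReg 27 = H - 1 - k ∧
    s'.intReg 28 = py₂ + 1 - 2 ^ k ∧ s'.intReg 25 = M + px₁ ∧ s'.intReg 26 = M + px₂)
    ((Runs.of_wp ?_).mono (by decide) fun _ _ h => h) ?_).mono (by omega) fun _ _ h => h
  · simp [g2, g3, g20, g21, g23, e24', hpw2]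
    omega
  rintro s3 f3 ⟨e27, e28, e25, e26⟩
  have hkk : H - 1 - (H - 1 - k) = k := by omega
  have hy2 : py₂ + 1 - 2 ^ k < M := by have : 0 < 2 ^ k := by positivity
                                       omega
  refine (insertLoop_runs (y₁ := py₁) (y₂ := py₂ + 1 - 2 ^ k) (j := H - 1 - k) (T := T) (ar := ar)
    (by rw [f3.int 2 rfl, g2]) (by rw [f3.int 3 rfl, g3])
    (by rw [f3.int 4 rfl, f2.int 4 rfl, f1.int 4 rfl, h4])
    (by rw [f3.int 22 rfl, f2.int 22 rfl, f1.int 22 rfl, h22]) e27 e28 e25 e26 hltp z.lt_S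
    (by omega) hpx₂ (by omega) (by omega) hy2 hid
    (by rw [f3.ints 0 rfl, f2.ints 0 rfl, f1.ints 0 rfl, hT])
    (by rw [f3.reals 8 rfl, f2.reals 8 rfl, f1.reals 8 rfl, har]) hTid hsound ?_).mono le_rfl ?_
  · intro px py h1 h2 h3 h4
    rw [hkk] at h4
    exact hcov px py h1 h2 h3 (by omega)
  · rintro s' - ⟨q1, q2, q3, q4⟩
    refine ⟨q1, q2, q3, fun px py h1 h2 h3 h4 => ?_⟩
    obtain ⟨v, hv, hanc, hv1, hv2⟩ := q4 px h1 h2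
    by_cases hc : py < py₁ + 2 ^ k
    · refine ⟨_, cellIdx_lt hv (by omega) (by omega), (region_cellIdx (by omega) (by omega)).2
        ⟨hanc, h3, by rw [hkk]; exact hc⟩, hv1⟩
    · refine ⟨_, cellIdx_lt hv (by omega) hy2, (region_cellIdx (by omega) hy2).2
        ⟨hanc, by omega, by rw [hkk]; omega⟩, hv2⟩

/-! ## Generating the boxes -/

/-- The constants and arrays that preprocessing sets up before it generates boxes. -/
structure Ready (A : Rect) (N M H : ℕ) (X Y Z : ℕ → ℝ) (s : State) : Prop where
  int1 : s.intReg 1 = N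
  int2 : s.intReg 2 = M
  int3 : s.intReg 3 = H
  real0 : s.realReg 0 = A.x₀
  real1 : s.realReg 1 = A.x₁
  real2 : s.realReg 2 = A.y₀
  reals0 : s.mem.reals 0 = X
  reals1 : s.mem.reals 1 = Y
  reals2 : s.mem.reals 2 = Z
  pow : ∀ k < H, s.mem.ints 1 k = 2 ^ k

theorem Ready.frame {A : Rect} {N M H : ℕ} {X Y Z : ℕ → ℝ} {s s' : State} {c : Cmd}
    (r : Ready A N M H X Y Z s) (f : Frame c s s')
    (h : (c.writesInt 1 || c.writesInt 2 || c.writesInt 3 || c.writesReal 0 || c.writesReal 1 ||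
      c.writesReal 2 || c.writesReals 0 || c.writesReals 1 || c.writesReals 2 ||
      c.writesInts 1) = false) : Ready A N M H X Y Z s' := by
  simp only [Bool.or_eq_false_iff] at h
  obtain ⟨⟨⟨⟨⟨⟨⟨⟨⟨h1, h2⟩, h3⟩, h4⟩, h5⟩, h6⟩, h7⟩, h8⟩, h9⟩, h10⟩ := h
  refine ⟨(f.int _ h1).trans r.int1, (f.int _ h2).trans r.int2, (f.int _ h3).trans r.int3,
    (f.real _ h4).trans r.real0, (f.real _ h5).trans r.real1, (f.real _ h6).trans r.real2,
    (f.reals _ h7).trans r.reals0, (f.reals _ h8).trans r.reals1, (f.reals _ h9).trans r.reals2,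
    ?_⟩
  rw [f.ints _ h10]
  exact r.pow

/-- The box with number `id` stored in the memory. -/
def Memory.box (m : Memory) (id : ℕ) : Box :=
  ⟨m.reals 4 id, m.reals 5 id, m.reals 6 id, m.reals 7 id⟩

/-- The area of the box entered in cell `i` of the table. -/
def Memory.value (m : Memory) (i : ℕ) : ℝ := m.reals 8 (m.ints 0 i)

/-- The memory holds valid boxes with numbers from 1 to `cnt`, and a table of such boxes in which
each box covers the region of its cell. -/
structure BoxTable (P : Set (ℝ × ℝ)) (N M H : ℕ) (X Y Z : ℕ → ℝ) (m : Memory) (cnt : ℕ) : Prop where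
  le : ∀ i, m.ints 0 i ≤ cnt
  zero : m.reals 8 0 = 0
  valid : ∀ id, 0 < id → id ≤ cnt → (m.box id).Valid P N X Y ∧ m.reals 8 id = (m.box id).area
  sound : TableSound M H (gridPos Z N) (gridPos Y N) m.box (m.ints 0)

/-- The table has entries at least as good as the box `b` wherever `b` can be used. -/
def Recorded (N M H : ℕ) (Y Z : ℕ → ℝ) (m : Memory) (b : Box) : Prop :=
  ∀ px < M, ∀ py < M, b.Covers (gridPos Z N) (gridPos Y N) px py →
    ∃ i < 2 * M * H * M, Region M H i px py ∧ b.area ≤ m.value i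

theorem Recorded.mono {N M H : ℕ} {Y Z : ℕ → ℝ} {m m' : Memory} {b : Box}
    (h : Recorded N M H Y Z m b) (hm : ∀ i, m.value i ≤ m'.value i) :
    Recorded N M H Y Z m' b := by
  intro px hpx py hpy hc
  obtain ⟨i, hi, hr, ha⟩ := h px hpx py hpy hc
  exact ⟨i, hi, hr, ha.trans (hm i)⟩

/-- Compute the position of the value in real register 10 and move it to integer register `x`. -/
def locateTo (x a : ℕ) (e : RealExpr) : Cmd :=
  .seq (.setReal 10 e) (.seq (locate a) (.setInt x (.reg 10)))

theorem locateTo_runs {S x a N M H : ℕ} {e : RealExpr} {s : State} {Z : ℕ → ℝ}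
    (z : Sizes S N M H) (hN : s.intReg 1 = N) (hZ : s.mem.reals a = Z)
    (hmono : ∀ i j, i ≤ j → j < N → Z i ≤ Z j) (he : e.Legal S s)
    (hv : ∃ i < N, e.eval s ≤ Z i) :
    Runs S (locateTo x a e) s (19 * H + 33 + e.cost)
      (fun s' => s'.intReg x = gridPos Z N (e.eval s)) := by
  have hMS := z.four_mul_lt
  have hM := z.hM
  have h0 : Runs S (.setReal 10 e) s (e.cost + 1) (fun s' => s'.realReg 10 = e.eval s) :=
    Runs.of_wp ⟨he, by simp⟩
  refine (Runs.seq' h0 (T' := 19 * H + 32) ?_).mono (by omega) fun _ _ h => h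
  rintro s1 f1 h10
  refine (Runs.seq' (locate_runs (a := a) (Z := Z) (N := N) (H := H)
    (by rw [f1.int 1 rfl, hN]) (by rw [f1.reals a rfl, hZ]) hmono
    (by have := z.lt_pow; omega) (by have := z.hN; omega)) (T' := 2) ?_).mono (by omega)
    fun _ _ h => h
  rintro s2 f2 h
  refine (Runs.of_wp ?_).mono (by simp [Cmd.maxCost, IntExpr.cost]) fun _ _ h => h
  have := gridPos_lt_two_mul hv
  rw [h10] at h
  simp [h]
  omega

/-- Store the box with the coordinates in real registers 4, 5, 7 and in the second coordinate of
the point in integer register 6, and enter it in the table. -/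
def emit : Cmd :=
  .seq (.seq (.setInt 4 (.add (.reg 4) (.const 1))) <|
    .seq (.storeReal 4 (.reg 4) (.reg 4)) <|
    .seq (.storeReal 5 (.reg 4) (.reg 5)) <|
    .seq (.storeReal 6 (.reg 4) (.reg 7)) <|
    .seq (.storeReal 7 (.reg 4) (.load 1 (.reg 6))) <|
    .storeReal 8 (.reg 4) (.mul (.sub (.reg 5) (.reg 4)) (.sub (.load 1 (.reg 6)) (.reg 7)))) <|
  .seq (locateTo 20 2 (.reg 4)) <|
  .seq (locateTo 21 2 (.reg 5)) <|
  .seq (locateTo 22 1 (.reg 7)) <|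
  .seq (locateTo 23 1 (.load 1 (.reg 6)))
  insert

/-- The new box gets the unused number `cnt + 1`. All table entries are at most `cnt`, so they keep
their boxes and areas when the arrays are written. -/
theorem emit_runs {A : Rect} {P : Set (ℝ × ℝ)} {S N M H cnt k : ℕ} {X Y Z : ℕ → ℝ} {s : State}
    {b : Box} (z : Sizes S N M H) (g : Grid A P N X Y Z) (r : Ready A N M H X Y Z s)
    (t : BoxTable P N M H X Y Z s.mem cnt) (h4 : s.intReg 4 = cnt) (hcnt : cnt + 1 < S)
    (h6 : s.intReg 6 = k) (hk : k < N)
    (hb : b = ⟨s.realReg 4, s.realReg 5, s.realReg 7, Y k⟩) (hv : b.Valid P N X Y) :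
    Runs S emit s (230 * H + 300) (fun s' => BoxTable P N M H X Y Z s'.mem (cnt + 1) ∧
      s'.intReg 4 = cnt + 1 ∧ Recorded N M H Y Z s'.mem b ∧
      ∀ i, s.mem.value i ≤ s'.mem.value i) := by
  have hMS := z.four_mul_lt
  have hM := z.hM
  have hy := r.reals1
  refine (Runs.seq' (T := 40) (T' := 230 * H + 260) (P := fun s' =>
    s'.intReg 4 = cnt + 1 ∧
    s'.mem.reals 4 = Function.update (s.mem.reals 4) (cnt + 1) b.x₀ ∧
    s'.mem.reals 5 = Function.update (s.mem.reals 5) (cnt + 1) b.x₁ ∧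
    s'.mem.reals 6 = Function.update (s.mem.reals 6) (cnt + 1) b.y₀ ∧
    s'.mem.reals 7 = Function.update (s.mem.reals 7) (cnt + 1) b.y₁ ∧
    s'.mem.reals 8 = Function.update (s.mem.reals 8) (cnt + 1) b.area)
    ((Runs.of_wp ?_).mono (by decide) fun _ _ h => h) ?_).mono (by omega) fun _ _ h => h
  · subst hb
    simp [h4, h6, hy, Box.area]
    omega
  rintro s1 f1 ⟨e4, m4, m5, m6, m7, m8⟩
  have r1 := r.frame f1 rfl
  have q4 : s1.realReg 4 = b.x₀ := by rw [f1.real 4 rfl, hb]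
  have q5 : s1.realReg 5 = b.x₁ := by rw [f1.real 5 rfl, hb]
  have q7 : s1.realReg 7 = b.y₀ := by rw [f1.real 7 rfl, hb]
  have q6 : s1.intReg 6 = k := by rw [f1.int 6 rfl, h6]
  have hY : Y k = b.y₁ := by rw [hb]
  have top : ∀ x, (∃ i < N, X i = x) → ∃ i < N, x ≤ Z i := by
    rintro _ ⟨i, hi, rfl⟩
    obtain ⟨j, hj, h⟩ := g.memZ i hi
    exact ⟨j, hj, h.ge⟩
  have topY : ∀ y, (∃ i < N, Y i = y) → ∃ i < N, y ≤ Y i := by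
    rintro _ ⟨i, hi, rfl⟩
    exact ⟨i, hi, le_rfl⟩
  have t0 := top _ hv.mx₀
  have t1 := top _ hv.mx₁
  have t2 := topY _ hv.my₀
  have t3 := topY _ hv.my₁
  refine (Runs.seq' (locateTo_runs (e := .reg 4) (x := 20) z r1.int1 r1.reals2 g.monoZ trivial
    (by simpa [q4] using t0)) (T' := 211 * H + 220) ?_).mono
    (by simp only [RealExpr.cost]; omega) fun _ _ h => h
  rintro s2 f2 e20
  have r2 := r1.frame f2 rfl
  simp only [RealExpr.eval, q4] at e20
  have q5' : s2.realReg 5 = b.x₁ := by rw [f2.real 5 rfl, q5]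
  refine (Runs.seq' (locateTo_runs (e := .reg 5) (x := 21) z r2.int1 r2.reals2 g.monoZ trivial
    (by simpa [q5'] using t1)) (T' := 192 * H + 180) ?_).mono
    (by simp only [RealExpr.cost]; omega) fun _ _ h => h
  rintro s3 f3 e21
  have r3 := r2.frame f3 rfl
  simp only [RealExpr.eval, q5'] at e21
  have q7' : s3.realReg 7 = b.y₀ := by rw [f3.real 7 rfl, f2.real 7 rfl, q7]
  refine (Runs.seq' (locateTo_runs (e := .reg 7) (x := 22) z r3.int1 r3.reals1 g.monoY trivial
    (by simpa [q7'] using t2)) (T' := 173 * H + 140) ?_).mono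
    (by simp only [RealExpr.cost]; omega) fun _ _ h => h
  rintro s4 f4 e22
  have r4 := r3.frame f4 rfl
  simp only [RealExpr.eval, q7'] at e22
  have q6' : s4.intReg 6 = k := by rw [f4.int 6 rfl, f3.int 6 rfl, f2.int 6 rfl, q6]
  refine (Runs.seq' (locateTo_runs (e := .load 1 (.reg 6)) (x := 23) z r4.int1 r4.reals1 g.monoY
    (by simp [q6']; omega) (by simpa [q6', r4.reals1, hY] using t3)) (T' := 150 * H + 100) ?_).mono
    (by simp only [RealExpr.cost, IntExpr.cost]; omega) fun _ _ h => h
  rintro s5 f5 e23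
  have r5 := r4.frame f5 rfl
  simp only [RealExpr.eval, IntExpr.eval, q6', r4.reals1, hY] at e23
  have w4 : s5.mem.reals 4 = s1.mem.reals 4 := by
    rw [f5.reals 4 rfl, f4.reals 4 rfl, f3.reals 4 rfl, f2.reals 4 rfl]
  have w5 : s5.mem.reals 5 = s1.mem.reals 5 := by
    rw [f5.reals 5 rfl, f4.reals 5 rfl, f3.reals 5 rfl, f2.reals 5 rfl]
  have w6 : s5.mem.reals 6 = s1.mem.reals 6 := by
    rw [f5.reals 6 rfl, f4.reals 6 rfl, f3.reals 6 rfl, f2.reals 6 rfl]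
  have w7 : s5.mem.reals 7 = s1.mem.reals 7 := by
    rw [f5.reals 7 rfl, f4.reals 7 rfl, f3.reals 7 rfl, f2.reals 7 rfl]
  have w8 : s5.mem.reals 8 = s1.mem.reals 8 := by
    rw [f5.reals 8 rfl, f4.reals 8 rfl, f3.reals 8 rfl, f2.reals 8 rfl]
  have w0 : s5.mem.ints 0 = s.mem.ints 0 := by
    rw [f5.ints 0 rfl, f4.ints 0 rfl, f3.ints 0 rfl, f2.ints 0 rfl, f1.ints 0 rfl]
  have hbox : ∀ id, s5.mem.box id = if id = cnt + 1 then b else s.mem.box id := by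
    intro id
    simp only [Memory.box, w4, w5, w6, w7, m4, m5, m6, m7, Function.update_apply]
    split_ifs <;> rfl
  have har : ∀ id, s5.mem.reals 8 id = if id = cnt + 1 then b.area else s.mem.reals 8 id := by
    intro id
    rw [w8, m8, Function.update_apply]
  refine (insert_runs (T := s.mem.ints 0) (ar := s5.mem.reals 8) (box := s5.mem.box)
    (fx := gridPos Z N) (fy := gridPos Y N) (id := cnt + 1) z r5.int2 r5.int3
    (by rw [f5.int 4 rfl, f4.int 4 rfl, f3.int 4 rfl, f2.int 4 rfl, e4])
    (by rw [f5.int 20 rfl, f4.int 20 rfl, f3.int 20 rfl, e20])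
    (by rw [f5.int 21 rfl, f4.int 21 rfl, e21]) (by rw [f5.int 22 rfl, e22]) e23 r5.pow
    (hM ▸ gridPos_lt_two_mul t0) (hM ▸ gridPos_lt_two_mul t1) (gridPos_mono hv.hy.le)
    (hM ▸ gridPos_lt_two_mul t3) hcnt w0 rfl (fun i => (t.le i).trans (by omega)) ?_ ?_).mono
    le_rfl ?_
  · intro i hi px hpx py hr
    rw [hbox, if_neg (by have := t.le i; omega)]
    exact t.sound i hi px hpx py hr
  · intro px py h1 h2 h3 h4
    rw [hbox, if_pos rfl]
    exact ⟨h1, h2, h3, h4⟩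
  · rintro s6 f6 ⟨u1, u2, u3, u4⟩
    have v8 : s6.mem.reals 8 = s5.mem.reals 8 := f6.reals 8 rfl
    have vbox : s6.mem.box = s5.mem.box := by
      funext id
      simp only [Memory.box]
      rw [f6.reals 4 rfl, f6.reals 5 rfl, f6.reals 6 rfl, f6.reals 7 rfl]
    refine ⟨⟨u1, ?_, ?_, ?_⟩, ?_, ?_, ?_⟩
    · rw [v8, har, if_neg (by omega), t.zero]
    · intro id h1 h2
      rw [vbox, v8, hbox, har]
      split_ifs with h
      · exact ⟨hv, rfl⟩
      · exact t.valid id h1 (by omega)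
    · rw [vbox]
      exact u2
    · rw [f6.int 4 rfl, f5.int 4 rfl, f4.int 4 rfl, f3.int 4 rfl, f2.int 4 rfl, e4]
    · rintro px - py - ⟨h1, h2, h3, h4⟩
      obtain ⟨i, hi, hr, ha⟩ := u4 px py h1 h2 h3 h4
      rw [har, if_pos rfl] at ha
      refine ⟨i, hi, hr, ?_⟩
      rw [Memory.value, v8]
      exact ha
    · intro i
      have := u3 i
      rw [har, if_neg (by have := t.le i; omega)] at this
      rw [Memory.value, Memory.value, v8]
      exact this

/-- Generate the boxes above the anchor with coordinates in real registers 6 and 7. -/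
def sweep : Cmd :=
  .seq (.seq (.setReal 4 (.reg 0)) (.setReal 5 (.reg 1))) <|
  forLoop 6 1 <|
    .ite (.realLt (.reg 7) (.load 1 (.reg 6)))
      (.seq (.ite (.realLt (.reg 4) (.reg 5)) emit .skip) <|
        .ite (.realLt (.reg 6) (.load 0 (.reg 6)))
          (.ite (.realLt (.load 0 (.reg 6)) (.reg 5)) (.setReal 5 (.load 0 (.reg 6))) .skip)
          (.ite (.realLt (.reg 4) (.load 0 (.reg 6))) (.setReal 4 (.load 0 (.reg 6))) .skip))
      .skip

/-- Box `k` is emitted before point `k` narrows the window, because its upper side passes through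
that point. Boxes skipped by the two tests are degenerate, hence not valid, and need not be
recorded. -/
theorem sweep_runs {A : Rect} {P : Set (ℝ × ℝ)} {S N M H cnt : ℕ} {X Y Z : ℕ → ℝ} {s : State}
    {xa ya : ℝ} (z : Sizes S N M H) (g : Grid A P N X Y Z) (r : Ready A N M H X Y Z s)
    (t : BoxTable P N M H X Y Z s.mem cnt) (h4 : s.intReg 4 = cnt) (hcnt : cnt + N < S)
    (h6 : s.realReg 6 = xa) (h7 : s.realReg 7 = ya) (hya : ∃ i < N, Y i = ya) :
    Runs S sweep s (N * (230 * H + 350) + 10) (fun s' => ∃ cnt' ≤ cnt + N,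
      BoxTable P N M H X Y Z s'.mem cnt' ∧ s'.intReg 4 = cnt' ∧
      (∀ k < N, (sweepBox A X Y xa ya k).Valid P N X Y →
        Recorded N M H Y Z s'.mem (sweepBox A X Y xa ya k)) ∧
      ∀ i, s.mem.value i ≤ s'.mem.value i) := by
  have hMS := z.four_mul_lt
  have hM := z.hM
  have a1 : Runs S (.seq (.setReal 4 (.reg 0)) (.setReal 5 (.reg 1))) s 4
      (fun s' => s'.realReg 4 = A.x₀ ∧ s'.realReg 5 = A.x₁) :=
    (Runs.of_wp (by simp [r.real0, r.real1])).mono (by decide) fun _ _ h => h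
  refine (Runs.seq' a1 (T' := N * (230 * H + 350) + 6) ?_).mono (by omega) fun _ _ h => h
  rintro s1 f1 ⟨e4, e5⟩
  have r1 := r.frame f1 rfl
  have hmem1 : s1.mem = s.mem := f1.mem_eq (fun _ => rfl) (fun _ => rfl)
  refine (Runs.forLoop (x := 6) (y := 1) (T := 230 * H + 342) (fun k s' => s'.realReg 4 = sweepL X Y A.x₀ xa ya k ∧
    s'.realReg 5 = sweepR X Y A.x₁ xa ya k ∧ ∃ cnt' ≤ cnt + k,
      BoxTable P N M H X Y Z s'.mem cnt' ∧ s'.intReg 4 = cnt' ∧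
      (∀ j < k, (sweepBox A X Y xa ya j).Valid P N X Y →
        Recorded N M H Y Z s'.mem (sweepBox A X Y xa ya j)) ∧
      ∀ i, s.mem.value i ≤ s'.mem.value i) rfl rfl (by decide) r1.int1 (by have := z.hN; omega)
    ⟨e4, e5, cnt, by omega, by rwa [hmem1], by rw [f1.int 4 rfl, h4], by simp, by simp [hmem1]⟩
    (fun i s v h => h) ?_).mono (by ring_nf; omega) fun _ _ h => h.2.2
  rintro k s2 hk i6 f2 ⟨l4, l5, cnt', hcnt', t2, c4, rec2, mon2⟩
  have r2 := r1.frame f2 rfl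
  have x6 : s2.realReg 6 = xa := by rw [f2.real 6 rfl, f1.real 6 rfl, h6]
  have x7 : s2.realReg 7 = ya := by rw [f2.real 7 rfl, f1.real 7 rfl, h7]
  refine (Runs.ite (T := 230 * H + 336) (by simp [i6]; omega) (fun hb => ?_)
    (fun hb => ?_)).mono (by simp only [Test.cost, RealExpr.cost, IntExpr.cost]; omega)
    fun _ _ h => h
  · simp only [Test.Holds, RealExpr.eval, IntExpr.eval, x7, i6, r2.reals1] at hb
    refine (Runs.seq' (T := 230 * H + 304) (T' := 30) (P := fun s' => s'.realReg 4 = s2.realReg 4 ∧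
      s'.realReg 5 = s2.realReg 5 ∧ s'.realReg 6 = xa ∧ s'.intReg 6 = k ∧ s'.mem.reals 0 = X ∧
      ∃ cnt' ≤ cnt + (k + 1), BoxTable P N M H X Y Z s'.mem cnt' ∧ s'.intReg 4 = cnt' ∧
      (∀ j < k + 1, (sweepBox A X Y xa ya j).Valid P N X Y →
        Recorded N M H Y Z s'.mem (sweepBox A X Y xa ya j)) ∧
      ∀ i, s.mem.value i ≤ s'.mem.value i) ?_ ?_).mono (by omega) fun _ _ h => h
    · refine (Runs.ite (T := 230 * H + 300) (by simp) (fun hc => ?_) (fun hc => ?_)).mono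
        (by simp only [Test.cost, RealExpr.cost]; omega) fun _ _ h => h
      · simp only [Test.Holds, RealExpr.eval, l4, l5] at hc
        refine (emit_runs (b := sweepBox A X Y xa ya k) z g r2 t2 c4 (by omega) i6 hk
          (by rw [l4, l5, x7]; rfl) (g.sweepBox_valid hk hya hb hc)).mono le_rfl ?_
        rintro s3 f3 ⟨t3, c3, rec3, mon3⟩
        refine ⟨f3.real 4 rfl, f3.real 5 rfl, by rw [f3.real 6 rfl, x6], by rw [f3.int 6 rfl, i6],
          by rw [f3.reals 0 rfl, r2.reals0], cnt' + 1, by omega, t3, c3, ?_,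
          fun i => (mon2 i).trans (mon3 i)⟩
        intro j hj hv
        rcases Nat.lt_succ_iff_lt_or_eq.1 hj with h | rfl
        · exact (rec2 j h hv).mono mon3
        · exact rec3
      · simp only [Test.Holds, RealExpr.eval, l4, l5] at hc
        refine (Runs.of_wp ?_).mono (by simp [Cmd.maxCost]) fun _ _ h => h
        refine ⟨rfl, rfl, x6, i6, r2.reals0, cnt', by omega, t2, c4, ?_, mon2⟩
        intro j hj hv
        rcases Nat.lt_succ_iff_lt_or_eq.1 hj with h | rfl
        · exact rec2 j h hv
        · exact absurd hv.hx hc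
    · rintro s3 f3 ⟨d4, d5, d6, d6', d0, rest⟩
      rw [l4] at d4
      rw [l5] at d5
      refine (Runs.of_wp ?_).mono (by decide) fun _ _ h => h
      simp only [wp, Test.Legal, RealExpr.Legal, IntExpr.Legal, Test.Holds, RealExpr.eval,
        IntExpr.eval, State.setReal_realReg, State.setReal_intReg, State.setReal_mem, d4, d5, d6,
        d6', d0, sweepL, sweepR, hb, true_and]
      have hkS : k < S := by omega
      refine ⟨hkS, fun h1 => ⟨⟨hkS, trivial⟩, fun h2 => ⟨hkS, ?_, ?_, rest⟩, fun h2 =>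
        ⟨?_, ?_, rest⟩⟩, fun h1 => ⟨hkS, fun h2 => ⟨hkS, ?_, ?_, rest⟩, fun h2 =>
        ⟨?_, ?_, rest⟩⟩⟩
      · simp [not_le.2 h1]
      · simp [h1, h2.le]
      · simp [not_le.2 h1]
      · simp [h1, not_lt.1 h2]
      · simp [not_lt.1 h1, h2.le]
      · simp [h1]
      · simp [not_lt.1 h1, not_lt.1 h2]
      · simp [h1]
  · simp only [Test.Holds, RealExpr.eval, IntExpr.eval, x7, i6, r2.reals1] at hb
    refine (Runs.of_wp ?_).mono (by simp [Cmd.maxCost]) fun _ _ h => h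
    refine ⟨by simp [sweepL, hb, l4], by simp [sweepR, hb, l5], cnt', by omega, t2, c4, ?_, mon2⟩
    intro j hj hv
    rcases Nat.lt_succ_iff_lt_or_eq.1 hj with h | rfl
    · exact rec2 j h hv
    · exact absurd hv.hy hb

/-- Generate the boxes above all grid points and above their projections to the lower side. -/
def generate : Cmd :=
  forLoop 5 1 <|
    .seq (.seq (.setReal 6 (.load 0 (.reg 5))) (.setReal 7 (.load 1 (.reg 5)))) <|
    .seq sweep <|
    .seq (.setReal 7 (.reg 2))
    sweep

/-- Each of the `N` grid points is swept once from its own height and once from the lower side of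
`A`. Every sweep adds at most `N` boxes, so the box counter stays below `S` by `hsq`. -/
theorem generate_runs {A : Rect} {P : Set (ℝ × ℝ)} {S N M H : ℕ} {X Y Z : ℕ → ℝ} {s : State}
    (z : Sizes S N M H) (g : Grid A P N X Y Z) (r : Ready A N M H X Y Z s)
    (t : BoxTable P N M H X Y Z s.mem 0) (h4 : s.intReg 4 = 0) :
    Runs S generate s (N * (2 * (N * (230 * H + 350)) + 38) + 6) (fun s' => ∃ cnt < S,
      BoxTable P N M H X Y Z s'.mem cnt ∧
      ∀ j < N, ∀ ya, (ya = Y j ∨ ya = A.y₀) → ∀ k < N, (sweepBox A X Y (X j) ya k).Valid P N X Y →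
        Recorded N M H Y Z s'.mem (sweepBox A X Y (X j) ya k)) := by
  have hMS := z.four_mul_lt
  have hM := z.hM
  have hsq : 2 * (N * N) + 4 * N < S := by
    have h1 := z.sq_lt
    have h2 := Nat.mul_le_mul_right N z.hN
    rw [hM] at h1
    have : 2 * N * (2 * N) = 4 * (N * N) := by ring
    omega
  refine (Runs.forLoop (x := 5) (y := 1) (T := 2 * (N * (230 * H + 350)) + 30) (fun i s' => ∃ cnt ≤ i * (2 * N),
      BoxTable P N M H X Y Z s'.mem cnt ∧ s'.intReg 4 = cnt ∧
      ∀ j < i, ∀ ya, (ya = Y j ∨ ya = A.y₀) → ∀ k < N, (sweepBox A X Y (X j) ya k).Valid P N X Y →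
        Recorded N M H Y Z s'.mem (sweepBox A X Y (X j) ya k)) rfl rfl (by decide) r.int1
    (by have := z.hN; omega) ⟨0, by omega, t, h4, by simp⟩ (fun i s v h => h) ?_).mono
    (by ring_nf; omega) ?_
  · rintro i s1 hi i5 f1 ⟨cnt, hcnt, t1, c4, rec1⟩
    have r1 := r.frame f1 rfl
    have hcS : cnt + 2 * N < S := by
      have := Nat.mul_le_mul_right (2 * N) hi.le
      have e : N * (2 * N) = 2 * (N * N) := by ring
      omega
    refine (Runs.seq' (T := 8) (T' := 2 * (N * (230 * H + 350)) + 22) (P := fun s' =>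
      s'.realReg 6 = X i ∧ s'.realReg 7 = Y i) ((Runs.of_wp ?_).mono (by decide) fun _ _ h => h)
      ?_).mono (by omega) fun _ _ h => h
    · simp [i5, r1.reals0, r1.reals1]
      omega
    rintro s2 f2 ⟨x6, x7⟩
    have r2 := r1.frame f2 rfl
    have hm2 : s2.mem = s1.mem := f2.mem_eq (fun _ => rfl) (fun _ => rfl)
    refine (Runs.seq' (sweep_runs z g r2 (by rwa [hm2]) (by rw [f2.int 4 rfl, c4]) (by omega)
      x6 x7 ⟨i, hi, rfl⟩) (T' := N * (230 * H + 350) + 12) ?_).mono (by omega) fun _ _ h => h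
    rintro s3 f3 ⟨cnt3, hcnt3, t3, c3, rec3, mon3⟩
    have r3 := r2.frame f3 rfl
    refine (Runs.seq' (T := 2) (T' := N * (230 * H + 350) + 10) (P := fun s' =>
      s'.realReg 7 = A.y₀) ((Runs.of_wp ?_).mono (by decide) fun _ _ h => h)
      ?_).mono (by omega) fun _ _ h => h
    · simp [r3.real2]
    rintro s4 f4 y7
    have r4 := r3.frame f4 rfl
    have hm4 : s4.mem = s3.mem := f4.mem_eq (fun _ => rfl) (fun _ => rfl)
    refine (sweep_runs z g r4 (by rwa [hm4]) (by rw [f4.int 4 rfl, c3]) (by omega)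
      (by rw [f4.real 6 rfl, f3.real 6 rfl, x6]) y7
      (by obtain ⟨i, hi, -, h⟩ := g.corner₀; exact ⟨i, hi, h⟩)).mono le_rfl ?_
    rintro s5 f5 ⟨cnt5, hcnt5, t5, c5, rec5, mon5⟩
    rw [hm4] at mon5
    rw [hm2] at mon3
    refine ⟨cnt5, by rw [Nat.succ_mul]; omega, t5, c5, ?_⟩
    intro j hj ya hya k hk hv
    rcases Nat.lt_succ_iff_lt_or_eq.1 hj with h | rfl
    · exact ((rec1 j h ya hya k hk hv).mono mon3).mono mon5
    · rcases hya with rfl | rfl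
      · exact (rec3 k hk hv).mono mon5
      · exact rec5 k hk hv
  · rintro s' - ⟨cnt, hcnt, t', -, rec'⟩
    refine ⟨cnt, ?_, t', rec'⟩
    have e : N * (2 * N) = 2 * (N * N) := by ring
    omega

/-! ## Completing the table -/

/-- Update the cells of the table in increasing order from the cells whose regions contain theirs.
Integer register 5 holds the number of the cell and register 30 the size of the table. -/
def complete : Cmd :=
  .seq (.setInt 30 (.mul (.mul (.mul (.const 2) (.reg 2)) (.reg 3)) (.reg 2))) <|
  forLoop 5 30 <|
    .seq (.seq (.setInt 6 (.div (.reg 5) (.reg 2))) <|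
      .seq (.setInt 7 (.sub (.reg 5) (.mul (.reg 6) (.reg 2)))) <|
      .seq (.setInt 8 (.div (.reg 6) (.reg 3))) <|
      .setInt 9 (.sub (.reg 6) (.mul (.reg 8) (.reg 3)))) <|
    .seq (.ite (.intLt (.const 0) (.reg 9))
      (.seq (.seq (.setInt 10 (.load 0 (.sub (.reg 5) (.reg 2))))
          (.setInt 11 (.load 1 (.sub (.sub (.reg 3) (.const 1)) (.reg 9))))) <|
        .seq (chmaxCmd (.reg 5) 10) <|
        .ite (.intLt (.reg 7) (.reg 11)) .skip
          (.seq (.setInt 10 (.load 0 (.sub (.sub (.reg 5) (.reg 2)) (.reg 11))))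
            (chmaxCmd (.reg 5) 10)))
      .skip) <|
    .seq (.setInt 10 (.load 0 (cellExpr (.div (.reg 8) (.const 2)) (.reg 9) (.reg 7))))
      (chmaxCmd (.reg 5) 10)

/-- The sources of a cell have twice as many rows or are attached to the parent node, so their
regions contain that of the cell. Copying their entries therefore preserves soundness. -/
theorem region_source {M H i px py : ℕ} (hM : 0 < M) (hH : 0 < H) (h : Region M H i px py) :
    (0 < i / M % H → Region M H (i - M) px py) ∧
    (0 < i / M % H → 2 ^ (H - 1 - i / M % H) ≤ i % M →
      Region M H (i - M - 2 ^ (H - 1 - i / M % H)) px py) ∧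
    Region M H (cellIdx M H (i / M / H / 2) (i / M % H) (i % M)) px py := by
  obtain ⟨⟨e, he⟩, h1, h2⟩ := h
  have hj : i / M % H < H := Nat.mod_lt _ hH
  have hy : i % M < M := Nat.mod_lt _ hM
  have hi := cellIdx_encode M H i
  set v := i / M / H
  set j := i / M % H
  set y := i % M
  have hup : 0 < j → i - M = cellIdx M H v (j - 1) y := by
    intro h
    obtain ⟨j', hj'⟩ : ∃ j', j = j' + 1 := ⟨j - 1, by omega⟩
    rw [← hi, hj']
    simp only [cellIdx, Nat.add_sub_cancel]
    rw [← add_assoc, Nat.succ_mul]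
    omega
  have hexp : 0 < j → H - 1 - (j - 1) = (H - 1 - j) + 1 := by omega
  refine ⟨fun h => ?_, fun h hw => ?_, ?_⟩
  · rw [hup h, region_cellIdx (by omega) hy, hexp h, pow_succ]
    exact ⟨⟨e, he⟩, h1, by omega⟩
  · have : i - M - 2 ^ (H - 1 - j) = cellIdx M H v (j - 1) (y - 2 ^ (H - 1 - j)) := by
      rw [hup h]
      unfold cellIdx
      omega
    rw [this, region_cellIdx (by omega) (by omega), hexp h, pow_succ]
    exact ⟨⟨e, he⟩, by omega, by omega⟩
  · rw [region_cellIdx hj hy]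
    refine ⟨⟨e + 1, ?_⟩, h1, h2⟩
    rw [pow_succ, ← Nat.div_div_eq_div_mul, he]

theorem cellIdx_parent_le (M H i : ℕ) :
    cellIdx M H (i / M / H / 2) (i / M % H) (i % M) ≤ i := by
  conv_rhs => rw [← cellIdx_encode M H i]
  unfold cellIdx
  have : i / M / H / 2 ≤ i / M / H := Nat.div_le_self _ _
  gcongr

theorem pulled_congr {M H i : ℕ} {val val' : ℕ → ℝ} (h : Pulled M H val i)
    (he : ∀ k ≤ i, val' k = val k) : Pulled M H val' i := by
  refine ⟨fun hj => ?_, fun hj hw => ?_, ?_⟩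
  · rw [he _ (Nat.sub_le _ _), he _ le_rfl]
    exact h.up hj
  · rw [he _ ((Nat.sub_le _ _).trans (Nat.sub_le _ _)), he _ le_rfl]
    exact h.shift hj hw
  · rw [he _ (cellIdx_parent_le M H i), he _ le_rfl]
    exact h.parent

/-- `T'` is obtained from `T` by improving the entry of cell `i`. -/
structure Improves (M H : ℕ) (fx fy : ℝ → ℕ) (box : ℕ → Box) (ar : ℕ → ℝ) (cnt i : ℕ)
    (T T' : ℕ → ℕ) : Prop where
  le : ∀ k, T' k ≤ cnt
  sound : TableSound M H fx fy box T'
  eq : ∀ k, k ≠ i → T' k = T k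
  mono : ∀ k, ar (T k) ≤ ar (T' k)

theorem Improves.chmax {M H : ℕ} {fx fy : ℝ → ℕ} {box : ℕ → Box} {ar : ℕ → ℝ} {cnt i : ℕ}
    {T T' : ℕ → ℕ} (h : Improves M H fx fy box ar cnt i T T') {a : ℕ}
    (ha : ∀ px py, Region M H i px py → Region M H a px py) :
    Improves M H fx fy box ar cnt i T (chmax ar T' i (T' a)) := by
  refine ⟨fun k => ?_, h.sound.chmax ar fun h0 px hpx py hr => h.sound a h0 px hpx py (ha px py hr),
    fun k hk => ?_, fun k => (h.mono k).trans (le_chmax _ _ _ _ _)⟩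
  · rcases chmax_cases ar T' i (T' a) k with e | ⟨-, e⟩ <;> rw [e] <;> exact h.le _
  · rcases chmax_cases ar T' i (T' a) k with e | ⟨e, -⟩
    · rw [e, h.eq k hk]
    · exact absurd e hk

/-- Stated in the updated table because a source can be the cell itself: node 0 is its own parent.
-/
theorem chmax_pulled (ar : ℕ → ℝ) (T : ℕ → ℕ) (i a : ℕ) :
    ar (chmax ar T i (T a) a) ≤ ar (chmax ar T i (T a) i) := by
  rcases chmax_cases ar T i (T a) a with e | ⟨e, -⟩
  · rw [e]
    exact le_chmax_self _ _ _ _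
  · rw [e]

theorem chmax_keeps {ar : ℕ → ℝ} {T : ℕ → ℕ} {i a id : ℕ} (h : ar (T a) ≤ ar (T i)) :
    ar (chmax ar T i id a) ≤ ar (chmax ar T i id i) := by
  rcases chmax_cases ar T i id a with e | ⟨e, -⟩
  · rw [e]
    exact h.trans (le_chmax _ _ _ _ _)
  · rw [e]

/-- All sources of a cell have smaller or equal index: coarser row levels precede finer ones within
a node, and parents precede children. One increasing pass therefore suffices, with constant work per
cell. -/
theorem complete_runs {S N M H cnt : ℕ} {s : State} {box : ℕ → Box} {fx fy : ℝ → ℕ}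
    {T : ℕ → ℕ} {ar : ℕ → ℝ} (z : Sizes S N M H)
    (h2 : s.intReg 2 = M) (h3 : s.intReg 3 = H) (hpw : ∀ k < H, s.mem.ints 1 k = 2 ^ k)
    (hcnt : cnt < S) (hT : s.mem.ints 0 = T) (har : s.mem.reals 8 = ar) (hTc : ∀ i, T i ≤ cnt)
    (hsound : TableSound M H fx fy box T) :
    Runs S complete s (2 * M * H * M * 150 + 20) (fun s' => (∀ i, s'.mem.ints 0 i ≤ cnt) ∧
      TableSound M H fx fy box (s'.mem.ints 0) ∧ (∀ i, ar (T i) ≤ ar (s'.mem.ints 0 i)) ∧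
      ∀ i < 2 * M * H * M, Pulled M H (fun k => ar (s'.mem.ints 0 k)) i) := by
  have hMS := z.four_mul_lt
  have hHS := z.H_lt
  have hH := z.hH
  have hM : 0 < M := by have := z.hM; have := z.hN; omega
  have hBS := z.lt_S
  set B := 2 * M * H * M with hB
  have a0 : Runs S (.setInt 30 (.mul (.mul (.mul (.const 2) (.reg 2)) (.reg 3)) (.reg 2))) s 8
      (fun s' => s'.intReg 30 = B) :=
    (Runs.of_wp (by simp [h2, h3, ← hB]; exact hBS)).mono (by decide) fun _ _ h => h
  refine (Runs.seq' a0 (T' := B * 150 + 6) ?_).mono (by omega) fun _ _ h => h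
  intro s1 f1 e30
  refine (Runs.forLoop (x := 5) (y := 30) (T := 142) (fun i s' => (∀ i, s'.mem.ints 0 i ≤ cnt) ∧
      TableSound M H fx fy box (s'.mem.ints 0) ∧ (∀ i, ar (T i) ≤ ar (s'.mem.ints 0 i)) ∧
      ∀ j < i, Pulled M H (fun k => ar (s'.mem.ints 0 k)) j) rfl rfl (by decide) e30 hBS
      ?_ (fun i s v h => h) ?_).mono (by omega) fun _ _ h => h
  · rw [f1.ints 0 rfl, hT]
    exact ⟨hTc, hsound, fun _ => le_rfl, by simp⟩
  rintro i s2 hi i5 f2 ⟨hle, hsnd, hmon, hpull⟩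
  set T₀ := s2.mem.ints 0 with hT₀
  have har2 : s2.mem.reals 8 = ar := by rw [f2.reals 8 rfl, f1.reals 8 rfl, har]
  have hpw2 : ∀ k < H, s2.mem.ints 1 k = 2 ^ k := by rw [f2.ints 1 rfl, f1.ints 1 rfl]; exact hpw
  have g2 : s2.intReg 2 = M := by rw [f2.int 2 rfl, f1.int 2 rfl, h2]
  have g3 : s2.intReg 3 = H := by rw [f2.int 3 rfl, f1.int 3 rfl, h3]
  have hiS : i < S := by omega
  have hjH : i / M % H < H := Nat.mod_lt _ hH
  have hyM : i % M < M := Nat.mod_lt _ hM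
  have hiM : i / M ≤ i := Nat.div_le_self _ _
  have hiMH : i / M / H ≤ i / M := Nat.div_le_self _ _
  have hsrc := fun px py (h : Region M H i px py) => region_source hM hH h
  have himp0 : Improves M H fx fy box ar cnt i T₀ T₀ := ⟨hle, hsnd, fun _ _ => rfl, fun _ => le_rfl⟩
  have hch : ∀ (s' : State) (T' : ℕ → ℕ) (a : ℕ), s'.intReg 5 = i → s'.mem.ints 0 = T' →
      s'.mem.reals 8 = ar → s'.intReg 10 = T' a → (∀ k, T' k ≤ cnt) →
      Runs S (chmaxCmd (.reg 5) 10) s' 11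
        (fun s'' => s''.mem.ints 0 = chmax ar T' i (T' a)) := by
    intro s' T' a e5 eT e8 e10 hl
    refine (chmaxCmd_runs (by simp) (by simpa [e5] using hiS) ?_ ?_).mono
      (by simp [IntExpr.cost]) ?_
    · rw [eT]; exact (hl _).trans_lt hcnt
    · rw [e10]; exact (hl _).trans_lt hcnt
    · rintro s'' - rfl
      simp [e5, eT, e8, e10]
  refine (Runs.seq' (T := 30) (T' := 112) (P := fun s' => s'.intReg 7 = i % M ∧
    s'.intReg 8 = i / M / H ∧ s'.intReg 9 = i / M % H) ((Runs.of_wp ?_).mono (by decide)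
    fun _ _ h => h) ?_).mono le_rfl fun _ _ h => h
  · have q1 : i - i / M * M = i % M := by have := Nat.div_add_mod' i M; omega
    have q2 : i / M - i / M / H * H = i / M % H := by have := Nat.div_add_mod' (i / M) H; omega
    simp [i5, g2, g3, q1, q2]
    omega
  rintro s3 f3 ⟨e7, e8, e9⟩
  have har3 : s3.mem.reals 8 = ar := by rw [f3.reals 8 rfl, har2]
  have hpw3 : ∀ k < H, s3.mem.ints 1 k = 2 ^ k := by rw [f3.ints 1 rfl]; exact hpw2
  have k2 : s3.intReg 2 = M := by rw [f3.int 2 rfl, g2]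
  have k3 : s3.intReg 3 = H := by rw [f3.int 3 rfl, g3]
  have k5 : s3.intReg 5 = i := by rw [f3.int 5 rfl, i5]
  have kT : s3.mem.ints 0 = T₀ := f3.ints 0 rfl
  refine (Runs.seq' (T := 75) (T' := 30) (P := fun s' =>
    Improves M H fx fy box ar cnt i T₀ (s'.mem.ints 0) ∧
    (0 < i / M % H → ar (s'.mem.ints 0 (i - M)) ≤ ar (s'.mem.ints 0 i)) ∧
    (0 < i / M % H → 2 ^ (H - 1 - i / M % H) ≤ i % M →
      ar (s'.mem.ints 0 (i - M - 2 ^ (H - 1 - i / M % H))) ≤ ar (s'.mem.ints 0 i)))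
    ?_ ?_).mono (by omega) fun _ _ h => h
  · refine (Runs.ite (T := 70) (by simp) (fun hb => ?_) (fun hb => ?_)).mono
      (by decide) fun _ _ h => h
    · simp only [Test.Holds, IntExpr.eval, e9] at hb
      have hwM : 2 ^ (H - 1 - i / M % H) ≤ M :=
        (Nat.pow_le_pow_right (by norm_num) (Nat.sub_le _ _)).trans z.pow_le
      refine (Runs.seq' (T := 14) (T' := 56) (P := fun s' => s'.intReg 10 = T₀ (i - M) ∧
        s'.intReg 11 = 2 ^ (H - 1 - i / M % H)) ((Runs.of_wp ?_).mono (by decide)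
        fun _ _ h => h) ?_).mono le_rfl fun _ _ h => h
      · have := hle (i - M)
        have hk : H - 1 - i / M % H < H := by omega
        simp [k2, k3, k5, kT, e9, hpw3 _ hk]
        omega
      rintro s4 f4 ⟨e10, e11⟩
      refine (Runs.seq' (hch s4 T₀ (i - M) (by rw [f4.int 5 rfl, k5]) (by rw [f4.ints 0 rfl, kT])
        (by rw [f4.reals 8 rfl, har3]) e10 hle) (T' := 45) ?_).mono (by omega) fun _ _ h => h
      intro s5 f5 eT5
      have himp1 := himp0.chmax fun px py h => (hsrc px py h).1 hb
      have hup := chmax_pulled ar T₀ i (i - M)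
      set T₁ := chmax ar T₀ i (T₀ (i - M))
      have l2 : s5.intReg 2 = M := by rw [f5.int 2 rfl, f4.int 2 rfl, k2]
      have l5 : s5.intReg 5 = i := by rw [f5.int 5 rfl, f4.int 5 rfl, k5]
      have l7 : s5.intReg 7 = i % M := by rw [f5.int 7 rfl, f4.int 7 rfl, e7]
      have l11 : s5.intReg 11 = 2 ^ (H - 1 - i / M % H) := by rw [f5.int 11 rfl, e11]
      refine (Runs.ite (T := 35) (by simp) (fun hc => ?_) (fun hc => ?_)).mono
        (by decide) fun _ _ h => h
      · simp only [Test.Holds, IntExpr.eval, l7, l11] at hc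
        refine (Runs.of_wp ?_).mono (by decide) fun _ _ h => h
        simp only [wp, eT5]
        exact ⟨himp1, fun _ => hup, fun _ h => by omega⟩
      · simp only [Test.Holds, IntExpr.eval, l7, l11, not_lt] at hc
        refine (Runs.seq' (T := 10) (T' := 11) (P := fun s' => s'.intReg 10 =
          T₁ (i - M - 2 ^ (H - 1 - i / M % H))) ((Runs.of_wp ?_).mono (by decide)
          fun _ _ h => h) ?_).mono (by omega) fun _ _ h => h
        · have := himp1.le (i - M - 2 ^ (H - 1 - i / M % H))
          simp [l2, l5, l11, eT5]
          omega
        intro s6 f6 e10'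
        refine (hch s6 T₁ _ (by rw [f6.int 5 rfl, l5]) (by rw [f6.ints 0 rfl, eT5])
          (by rw [f6.reals 8 rfl, f5.reals 8 rfl, f4.reals 8 rfl, har3]) e10' himp1.le).mono
          le_rfl ?_
        rintro s7 - eT7
        rw [eT7]
        exact ⟨himp1.chmax fun px py h => (hsrc px py h).2.1 hb hc, fun _ => chmax_keeps hup,
          fun _ _ => chmax_pulled _ _ _ _⟩
    · simp only [Test.Holds, IntExpr.eval, e9] at hb
      refine (Runs.of_wp ?_).mono (by decide) fun _ _ h => h
      simp only [wp, kT]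
      exact ⟨himp0, fun h => absurd h hb, fun h => absurd h hb⟩
  · rintro s4 f4 ⟨himp, hup, hshift⟩
    set T₁ := s4.mem.ints 0 with hT₁
    have l2 : s4.intReg 2 = M := by rw [f4.int 2 rfl, k2]
    have l3 : s4.intReg 3 = H := by rw [f4.int 3 rfl, k3]
    have l5 : s4.intReg 5 = i := by rw [f4.int 5 rfl, k5]
    have l7 : s4.intReg 7 = i % M := by rw [f4.int 7 rfl, e7]
    have l8 : s4.intReg 8 = i / M / H := by rw [f4.int 8 rfl, e8]
    have l9 : s4.intReg 9 = i / M % H := by rw [f4.int 9 rfl, e9]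
    have hpar := cellIdx_parent_le M H i
    refine (Runs.seq' (T := 14) (T' := 11) (P := fun s' => s'.intReg 10 =
      T₁ (cellIdx M H (i / M / H / 2) (i / M % H) (i % M))) ((Runs.of_wp ?_).mono (by decide)
      fun _ _ h => h) ?_).mono (by omega) fun _ _ h => h
    · have := himp.le (cellIdx M H (i / M / H / 2) (i / M % H) (i % M))
      unfold cellIdx at this hpar
      simp [cellExpr, l2, l3, l7, l8, l9, ← hT₁, cellIdx]
      omega
    intro s5 f5 e10
    refine (hch s5 T₁ _ (by rw [f5.int 5 rfl, l5]) (by rw [f5.ints 0 rfl])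
      (by rw [f5.reals 8 rfl, f4.reals 8 rfl, har3]) e10 himp.le).mono le_rfl ?_
    intro s6 f6 eT6
    have himp2 := himp.chmax fun px py h => (hsrc px py h).2.2
    rw [eT6]
    refine ⟨himp2.le, himp2.sound, fun k => (hmon k).trans (himp2.mono k), fun k hk => ?_⟩
    -- For an earlier cell, `Pulled` involves only indices up to that cell, where the table has not
    -- changed in this round.
    rcases Nat.lt_succ_iff_lt_or_eq.1 hk with h | rfl
    · exact pulled_congr (hpull k h) fun k' hk' => by rw [himp2.eq k' (by omega)]
    · exact ⟨fun h => chmax_keeps (hup h), fun h hw => chmax_keeps (hshift h hw),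
        chmax_pulled _ _ _ _⟩

/-! ## Sorting and setting up -/

/-- Exchange the entries of the real array `a` with the indices in registers 5 and 6. -/
def swap (a : ℕ) : Cmd :=
  .seq (.setReal 9 (.load a (.reg 5))) <|
  .seq (.storeReal a (.reg 5) (.load a (.reg 6)))
  (.storeReal a (.reg 6) (.reg 9))

/-- Sort the first `N` entries of the real array `a`, and rearrange `b` in the same way. -/
def sortPairs (a b : ℕ) : Cmd :=
  forLoop 5 1 <| forLoop 6 1 <|
    .ite (.and (.intLt (.reg 5) (.reg 6)) (.realLt (.load a (.reg 6)) (.load a (.reg 5))))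
      (.seq (swap a) (swap b)) .skip

/-- An exchange is composition with a transposition, so the sorted array is the original one
composed with a permutation, and a companion array moved by the same permutation keeps the pairs
together. -/
theorem update_update_eq_comp_swap (f : ℕ → ℝ) (i j : ℕ) :
    Function.update (Function.update f i (f j)) j (f i) = f ∘ Equiv.swap i j := by
  funext k
  simp only [Function.update_apply, Function.comp, Equiv.swap_apply_def]
  split_ifs <;> simp_all

/-- Quadratic exchange sort, which fits the time bound: after `i` rounds, each of the first `i`
entries is at most every later one. -/
theorem sortPairs_runs {S N a b : ℕ} {s : State} (hab : a ≠ b) (h1 : s.intReg 1 = N) (hN : N < S) :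
    Runs S (sortPairs a b) s (N * (N * 50 + 14) + 6) (fun s' => ∃ σ : Equiv.Perm ℕ,
      (∀ i, σ i < N ↔ i < N) ∧ s'.mem.reals a = s.mem.reals a ∘ σ ∧
      s'.mem.reals b = s.mem.reals b ∘ σ ∧
      ∀ i j, i ≤ j → j < N → s'.mem.reals a i ≤ s'.mem.reals a j) := by
  have hba := hab.symm
  refine (Runs.forLoop (x := 5) (y := 1) (T := N * 50 + 6) (fun i s' => ∃ σ : Equiv.Perm ℕ,
      (∀ i, σ i < N ↔ i < N) ∧ s'.mem.reals a = s.mem.reals a ∘ σ ∧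
      s'.mem.reals b = s.mem.reals b ∘ σ ∧
      ∀ p < i, ∀ q, p < q → q < N → s'.mem.reals a p ≤ s'.mem.reals a q) rfl rfl (by decide) h1 hN
      ⟨1, by simp, rfl, rfl, by simp⟩ (fun i s v h => h) ?_).mono (by ring_nf; omega) ?_
  · rintro i s1 hi i5 f1 ⟨σ₁, hσ₁, ha₁, hb₁, hs₁⟩
    refine (Runs.forLoop (x := 6) (y := 1) (T := 42) (fun j s' => ∃ σ : Equiv.Perm ℕ,
      (∀ i, σ i < N ↔ i < N) ∧ s'.mem.reals a = s.mem.reals a ∘ σ ∧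
      s'.mem.reals b = s.mem.reals b ∘ σ ∧
      (∀ p < i, ∀ q, p < q → q < N → s'.mem.reals a p ≤ s'.mem.reals a q) ∧
      ∀ q, i < q → q < j → s'.mem.reals a i ≤ s'.mem.reals a q) rfl rfl (by decide)
      (by rw [f1.int 1 rfl, h1]) hN ⟨σ₁, hσ₁, ha₁, hb₁, hs₁, by simp⟩ (fun i s v h => h) ?_).mono
      (by omega) ?_
    · rintro j s2 hj i6 f2 ⟨σ, hσ, ha, hb, hs, hm⟩
      have e5 : s2.intReg 5 = i := by rw [f2.int 5 rfl, i5]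
      refine (Runs.ite (T := 24) (by simp [e5, i6]; omega) (fun hc => ?_) (fun hc => ?_)).mono
        (by simp [Test.cost, RealExpr.cost, IntExpr.cost]) fun _ _ h => h
      · simp only [Test.Holds, IntExpr.eval, RealExpr.eval, e5, i6] at hc
        obtain ⟨hij, hlt⟩ := hc
        have hw : Runs S (.seq (swap a) (swap b)) s2 24 (fun s' =>
            s'.mem.reals a = s2.mem.reals a ∘ Equiv.swap i j ∧
            s'.mem.reals b = s2.mem.reals b ∘ Equiv.swap i j) := by
          refine (Runs.of_wp ?_).mono (by simp [swap, Cmd.maxCost, RealExpr.cost, IntExpr.cost])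
            fun _ _ h => h
          simp [swap, e5, i6, hab, hba, update_update_eq_comp_swap]
          omega
        refine hw.mono le_rfl ?_
        rintro s3 - ⟨ha3, hb3⟩
        have hp : ∀ p < i, Equiv.swap i j p = p := fun p hp =>
          Equiv.swap_apply_of_ne_of_ne (by omega) (by omega)
        have hsw : ∀ q, (Equiv.swap i j q < N ↔ q < N) ∧ ∀ p < i, p < q → p < Equiv.swap i j q := by
          intro q
          rw [Equiv.swap_apply_def]
          split_ifs <;> refine ⟨by omega, fun p _ _ => by omega⟩
        refine ⟨σ * Equiv.swap i j, fun k => ?_, ?_, ?_, fun p hpi q hpq hq => ?_,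
          fun q hq hq' => ?_⟩
        · rw [Equiv.Perm.mul_apply, hσ, (hsw k).1]
        · rw [ha3, ha]; rfl
        · rw [hb3, hb]; rfl
        · rw [ha3, Function.comp, Function.comp, hp p hpi]
          exact hs p hpi _ ((hsw q).2 p hpi hpq) ((hsw q).1.2 hq)
        · rw [ha3, Function.comp, Function.comp, Equiv.swap_apply_left]
          rcases Nat.lt_succ_iff_lt_or_eq.1 hq' with h | rfl
          · rw [Equiv.swap_apply_of_ne_of_ne (by omega) (by omega)]
            exact hlt.le.trans (hm q hq h)
          · rw [Equiv.swap_apply_right]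
            exact hlt.le
      · simp only [Test.Holds, IntExpr.eval, RealExpr.eval, e5, i6, not_and, not_lt] at hc
        refine (Runs.of_wp ?_).mono (by simp [Cmd.maxCost]) fun _ _ h => h
        refine ⟨σ, hσ, ha, hb, hs, fun q hq hq' => ?_⟩
        rcases Nat.lt_succ_iff_lt_or_eq.1 hq' with h | rfl
        · exact hm q hq h
        · exact hc hq
    · rintro s2 - ⟨σ, hσ, ha, hb, hs, hm⟩
      refine ⟨σ, hσ, ha, hb, fun p hp q hpq hq => ?_⟩
      rcases Nat.lt_succ_iff_lt_or_eq.1 hp with h | rfl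
      · exact hs p h q hpq hq
      · exact hm q hpq hq
  · rintro s' - ⟨σ, hσ, ha, hb, hs⟩
    refine ⟨σ, hσ, ha, hb, fun i j hij hj => ?_⟩
    rcases hij.eq_or_lt with rfl | h
    · exact le_rfl
    · exact hs i (by omega) j h hj

/-- Compute the powers of two up to `M` (register 2) in the integer array 1 and their number in
register 3. -/
def powers : Cmd :=
  .seq (.seq (.setInt 3 (.const 0)) (.setInt 5 (.const 1))) <|
  .while (.not (.intLt (.reg 2) (.reg 5))) <|
    .seq (.storeInt 1 (.reg 3) (.reg 5)) <|
    .seq (.setInt 5 (.mul (.const 2) (.reg 5)))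
    (.setInt 3 (.add (.reg 3) (.const 1)))

/-- The machine has no logarithm. Doubling until `M` is exceeded counts the powers of two up to `M`,
of which there are `Nat.log 2 M + 1`. -/
theorem powers_runs {S N M : ℕ} {s : State} (z : Sizes S N M (Nat.log 2 M + 1))
    (h2 : s.intReg 2 = M) :
    Runs S powers s (20 * (Nat.log 2 M + 1) + 10) (fun s' => s'.intReg 3 = Nat.log 2 M + 1 ∧
      ∀ k < Nat.log 2 M + 1, s'.mem.ints 1 k = 2 ^ k) := by
  have hMS := z.four_mul_lt
  have hHS := z.H_lt
  have hM : M ≠ 0 := by have := z.hM; have := z.hN; omega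
  refine (Runs.seq' (T := 4) (T' := 20 * (Nat.log 2 M + 1) + 6) (P := fun s' =>
    s'.intReg 3 = 0 ∧ s'.intReg 5 = 1) ((Runs.of_wp (by simp; omega)).mono (by decide)
    fun _ _ h => h) ?_).mono (by omega) fun _ _ h => h
  rintro s1 f1 ⟨e3, e5⟩
  have g2 : s1.intReg 2 = M := by rw [f1.int 2 rfl, h2]
  refine (Runs.whileLoop (T := 11) (fun m s' => ∃ h, m + h = Nat.log 2 M + 1 ∧ s'.intReg 3 = h ∧
    s'.intReg 5 = 2 ^ h ∧ ∀ k < h, s'.mem.ints 1 k = 2 ^ k) (Nat.log 2 M + 1) s1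
    ⟨0, rfl, e3, e5, by simp⟩ ?_).mono (by simp only [Test.cost, IntExpr.cost]; omega)
    fun _ _ h => h
  rintro m s2 f2 ⟨h, hm, d3, d5, hpw⟩
  have g2' : s2.intReg 2 = M := by rw [f2.int 2 rfl, g2]
  refine ⟨⟨trivial, trivial⟩, fun hb => ?_, fun hb => ?_⟩
  · simp only [Test.Holds, IntExpr.eval, g2', d5, not_lt] at hb
    have hlog := (Nat.le_log_iff_pow_le (by norm_num) hM).2 hb
    refine ⟨m - 1, by omega, (Runs.of_wp ?_).mono (by decide) fun _ _ h => h⟩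
    simp only [wp, IntExpr.Legal, IntExpr.eval, State.setInt_intReg, State.storeInt_intReg,
      State.setInt_mem, State.storeInt_ints, d3, d5]
    refine ⟨trivial, by omega, trivial, by omega, by simp, by omega, by simp, by simp; omega,
      h + 1, by omega, by simp, by simp [pow_succ, mul_comm], fun k hk => ?_⟩
    rcases Nat.lt_succ_iff_lt_or_eq.1 hk with hk' | rfl
    · simp [hk'.ne, hpw k hk']
    · simp
  · simp only [Test.Holds, IntExpr.eval, g2', d5, not_not] at hb
    have hlog := (Nat.log_lt_iff_lt_pow (by norm_num) hM).2 hb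
    obtain rfl : h = Nat.log 2 M + 1 := by omega
    exact ⟨d3, hpw⟩

/-! ### Correctness of a completed table -/

theorem BoxTable.congr {P : Set (ℝ × ℝ)} {N M H cnt : ℕ} {X Y Z : ℕ → ℝ} {m m' : Memory}
    (t : BoxTable P N M H X Y Z m cnt) (h0 : ∀ i, m'.ints 0 i ≤ cnt)
    (hs : TableSound M H (gridPos Z N) (gridPos Y N) m.box (m'.ints 0))
    (h4 : m'.reals 4 = m.reals 4) (h5 : m'.reals 5 = m.reals 5) (h6 : m'.reals 6 = m.reals 6)
    (h7 : m'.reals 7 = m.reals 7) (h8 : m'.reals 8 = m.reals 8) :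
    BoxTable P N M H X Y Z m' cnt := by
  have hb : m'.box = m.box := by
    funext id
    simp only [Memory.box, h4, h5, h6, h7]
  exact ⟨h0, by rw [h8, t.zero], by rw [hb, h8]; exact t.valid, by rw [hb]; exact hs⟩

/-- In a completed table, the cell of the position of `q` holds a largest empty rectangle
containing `q`. -/
theorem BoxTable.exists_isLargestEmptyAt {A : Rect} {P : Set (ℝ × ℝ)} {S N M H cnt : ℕ}
    {X Y Z : ℕ → ℝ} {m : Memory} (z : Sizes S N M H) (g : Grid A P N X Y Z)
    (t : BoxTable P N M H X Y Z m cnt)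
    (hrec : ∀ j < N, ∀ ya, (ya = Y j ∨ ya = A.y₀) → ∀ k < N,
      (sweepBox A X Y (X j) ya k).Valid P N X Y →
        Recorded N M H Y Z m (sweepBox A X Y (X j) ya k))
    (hp : ∀ i < 2 * M * H * M, Pulled M H m.value i) {q : ℝ × ℝ} (hq : q ∈ A.region) :
    ∃ R : Rect, R.IsLargestEmptyAt A P q ∧
      m.box (m.ints 0 (cellIdx M H (M + gridPos Z N q.1) (H - 1) (gridPos Y N q.2))) =
        ⟨R.x₀, R.x₁, R.y₀, R.y₁⟩ := by
  obtain ⟨c, hc, hcx, hcy⟩ := g.corner₁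
  have hpx : gridPos Z N q.1 < M := by
    obtain ⟨c', hc', h⟩ := g.memZ c hc
    exact z.hM ▸ gridPos_lt_two_mul ⟨c', hc', by rw [h, hcx]; exact hq.1.2⟩
  have hpy : gridPos Y N q.2 < M :=
    z.hM ▸ gridPos_lt_two_mul ⟨c, hc, by rw [hcy]; exact hq.2.2⟩
  set px := gridPos Z N q.1 with hpx'
  set py := gridPos Y N q.2 with hpy'
  set leaf := cellIdx M H (M + px) (H - 1) py with hleaf
  have hH := z.hH
  -- Upper bound: a rectangle containing `q` lies in some sweep box, which is recorded in a cell
  -- whose region contains the positions of `q`, and the leaf cell is at least as good.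
  have hbest : ∀ R' : Rect, R'.IsEmptyIn A P → q ∈ R'.region → R'.area ≤ m.value leaf := by
    intro R' hR' hqR'
    obtain ⟨i, hi, ya, hya, k, hk, h1, h2, h3, h4⟩ := g.exists_anchor hR'
    have hx := R'.hx
    have hy := R'.hy
    have hv : (sweepBox A X Y (X i) ya k).Valid P N X Y := by
      refine g.sweepBox_valid hk ?_ (by linarith) (by linarith)
      rcases hya with rfl | rfl
      · exact ⟨i, hi, rfl⟩
      · obtain ⟨c, hc, -, h⟩ := g.corner₀
        exact ⟨c, hc, h⟩
    obtain ⟨⟨hq1, hq2⟩, hq3, hq4⟩ := hqR'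
    obtain ⟨idx, hidx, hr, ha⟩ := hrec i hi ya hya k hk hv px hpx py hpy
      ⟨gridPos_mono (h3.trans hq1), gridPos_mono (hq2.trans h4), gridPos_mono (h1.trans hq3),
        gridPos_mono (hq4.trans h2)⟩
    refine le_trans ?_ (ha.trans (val_le_leaf hp hidx hpx hpy hr))
    exact mul_le_mul (sub_le_sub h4 h3) (sub_le_sub h2 h1) (sub_nonneg.2 hy.le)
      (sub_nonneg.2 hv.hx.le)
  -- Entry 0 stands for no box and has area 0. Some empty rectangle of positive area contains `q`,
  -- so the leaf holds a genuine box.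
  obtain ⟨R₀, hR₀, hqR₀⟩ := g.exists_isEmptyIn hq
  have hpos : 0 < m.value leaf := lt_of_lt_of_le
    (mul_pos (sub_pos.2 R₀.hx) (sub_pos.2 R₀.hy)) (hbest R₀ hR₀ hqR₀)
  have hne : m.ints 0 leaf ≠ 0 := by
    intro h
    rw [Memory.value, h, t.zero] at hpos
    exact lt_irrefl _ hpos
  obtain ⟨hv, harea⟩ := t.valid _ (Nat.pos_of_ne_zero hne) (t.le _)
  obtain ⟨hc1, hc2, hc3, hc4⟩ := t.sound leaf hne px hpx py
    ((region_cellIdx (by omega) hpy).2 ⟨⟨0, by simp⟩, le_rfl, by simp⟩)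
  set b := m.box (m.ints 0 leaf)
  have hZ : ∀ x, (∃ i < N, X i = x) → ∃ i < N, Z i = x := by
    rintro _ ⟨i, hi, rfl⟩
    exact g.memZ i hi
  refine ⟨⟨b.x₀, b.x₁, b.y₀, b.y₁, hv.hx, hv.hy⟩, ⟨Rect.isEmptyIn_iff.2 ⟨?_, hv.empty⟩, ?_, ?_⟩,
    rfl⟩
  · obtain ⟨i, hi, h1⟩ := hv.mx₀
    obtain ⟨j, hj, h2⟩ := hv.mx₁
    obtain ⟨k, hk, h3⟩ := hv.my₀
    obtain ⟨l, hl, h4⟩ := hv.my₁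
    exact ⟨(g.mem i hi).1.1.trans_eq h1, h2.ge.trans (g.mem j hj).1.2,
      (g.mem k hk).2.1.trans_eq h3, h4.ge.trans (g.mem l hl).2.2⟩
  · exact ⟨⟨(gridPos_le_iff (hZ _ hv.mx₀)).1 hc1, (le_gridPos_iff (hZ _ hv.mx₁)).1 hc2⟩,
      (gridPos_le_iff hv.my₀).1 hc3, (le_gridPos_iff hv.my₁).1 hc4⟩
  · intro R' hR' hqR'
    refine (hbest R' hR' hqR').trans (le_of_eq ?_)
    rw [Memory.value, harea]
    rfl

/-! ## The preprocessing program -/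

/-- Add two opposite corners of `A` to the points, and compute the sizes. -/
def addCorners : Cmd :=
  .seq (.setInt 1 (.add (.reg 0) (.const 2))) <|
  .seq (.setInt 2 (.mul (.const 2) (.reg 1))) <|
  .seq (.storeReal 0 (.reg 0) (.reg 0)) <|
  .seq (.storeReal 1 (.reg 0) (.reg 2)) <|
  .seq (.storeReal 0 (.add (.reg 0) (.const 1)) (.reg 1))
  (.storeReal 1 (.add (.reg 0) (.const 1)) (.reg 3))

/-- Copy the first coordinates of the points to the real array 2. -/
def copyX : Cmd :=
  forLoop 5 1 (.storeReal 2 (.reg 5) (.load 0 (.reg 5)))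

/-- Store the sizes of the data structure in the integer array 2. -/
def storeSizes : Cmd :=
  .seq (.storeInt 2 (.const 0) (.reg 1)) <|
  .seq (.storeInt 2 (.const 1) (.reg 2))
  (.storeInt 2 (.const 2) (.reg 3))

/-- Sort the points by their second coordinates, and separately their first coordinates. -/
def buildGrid : Cmd :=
  .seq addCorners <| .seq (sortPairs 1 0) <| .seq copyX (sortPairs 2 3)

/-- The preprocessing program. -/
def preprocess : Cmd :=
  .seq buildGrid <| .seq powers <| .seq generate <| .seq complete storeSizes

/-- The corners `(x₀, y₀)` and `(x₁, y₁)` already supply all four side coordinates of `A`. The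
permutation `σ` sorts whole points by height, while `τ` sorts a copy of the abscissas alone. -/
theorem buildGrid_runs {n S M H : ℕ} {A : Rect} {p : Fin n → ℝ × ℝ} (hp : ∀ i, p i ∈ A.region)
    (z : Sizes S (n + 2) M H) :
    Runs S buildGrid (qmerInput A p) (2 * ((n + 2) * ((n + 2) * 50 + 14)) + (n + 2) * 13 + 60)
      (fun s => ∃ X Y Z, Grid A (Set.range p) (n + 2) X Y Z ∧ s.mem.reals 0 = X ∧
        s.mem.reals 1 = Y ∧ s.mem.reals 2 = Z ∧ s.intReg 1 = n + 2 ∧ s.intReg 2 = M) := by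
  have hMS := z.four_mul_lt
  have hM := z.hM
  set N := n + 2 with hN
  refine (Runs.seq' (T := 30) (T' := 2 * (N * (N * 50 + 14)) + N * 13 + 30) (P := fun s =>
    s.intReg 1 = N ∧ s.intReg 2 = M ∧
    (∀ i (h : i < n), s.mem.reals 0 i = (p ⟨i, h⟩).1 ∧ s.mem.reals 1 i = (p ⟨i, h⟩).2) ∧
    s.mem.reals 0 n = A.x₀ ∧ s.mem.reals 1 n = A.y₀ ∧ s.mem.reals 0 (n + 1) = A.x₁ ∧
    s.mem.reals 1 (n + 1) = A.y₁) ((Runs.of_wp ?_).mono (by decide) fun _ _ h => h) ?_).mono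
    (by omega) fun _ _ h => h
  · simp only [addCorners, wp, IntExpr.Legal, IntExpr.eval, RealExpr.Legal, RealExpr.eval]
    simp [qmerInput, Function.update_apply]
    refine ⟨by omega, by omega, by omega, by omega, by omega, by omega, fun i hi => ?_⟩
    have h1 : i ≠ n := by omega
    have h2 : i ≠ n + 1 := by omega
    simp [h1, h2, hi]
  rintro s1 f1 ⟨e1, e2, hpts, hx0, hy0, hx1, hy1⟩
  set X₁ := s1.mem.reals 0
  set Y₁ := s1.mem.reals 1
  refine (Runs.seq' (sortPairs_runs (a := 1) (b := 0) (by decide) e1 (by omega))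
    (T' := N * (N * 50 + 14) + N * 13 + 24) ?_).mono (by omega) fun _ _ h => h
  rintro s2 f2 ⟨σ, hσ, hY, hX, hmonoY⟩
  have g1 : s2.intReg 1 = N := by rw [f2.int 1 rfl, e1]
  set X := s2.mem.reals 0
  set Y := s2.mem.reals 1
  refine (Runs.seq' (T := N * 13 + 6) (T' := N * (N * 50 + 14) + 6)
    (P := fun s => ∀ i < N, s.mem.reals 2 i = X i)
    ((Runs.forLoop (x := 5) (y := 1) (T := 5) (fun i s => ∀ j < i, s.mem.reals 2 j = X j) rfl rfl
      (by decide) g1 (by omega) (by simp) (fun i s v h => h) ?_).mono le_rfl fun _ _ h => h)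
    ?_).mono (by omega) fun _ _ h => h
  · intro i s hi e5 f ih
    have hX' : s.mem.reals 0 = X := f.reals 0 rfl
    refine (Runs.of_wp ?_).mono (by decide) fun _ _ h => h
    simp [e5, hX', Function.update_apply]
    refine ⟨by omega, fun j hj => ?_⟩
    split_ifs with h
    · rw [h]
    · exact ih j (by omega)
  intro s3 f3 h3
  have f3X : s3.mem.reals 0 = X := f3.reals 0 rfl
  have f3Y : s3.mem.reals 1 = Y := f3.reals 1 rfl
  -- Array 3 is a dummy companion; only the sorted array 2 matters.
  refine (sortPairs_runs (a := 2) (b := 3) (by decide) (by rw [f3.int 1 rfl, g1])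
    (by omega)).mono (by omega) ?_
  rintro s4 f4 ⟨τ, hτ, hZ, -, hmonoZ⟩
  have hall : ∀ i < N, (∃ h : i < n, X₁ i = (p ⟨i, h⟩).1 ∧ Y₁ i = (p ⟨i, h⟩).2) ∨
      (X₁ i = A.x₀ ∧ Y₁ i = A.y₀) ∨ (X₁ i = A.x₁ ∧ Y₁ i = A.y₁) := by
    intro i hi
    rcases lt_trichotomy i n with h | rfl | h
    · exact .inl ⟨h, hpts i h⟩
    · exact .inr (.inl ⟨hx0, hy0⟩)
    · obtain rfl : i = n + 1 := by omega
      exact .inr (.inr ⟨hx1, hy1⟩)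
  have eX : ∀ i, X i = X₁ (σ i) := fun i => congrFun hX i
  have eY : ∀ i, Y i = Y₁ (σ i) := fun i => congrFun hY i
  have hXσ : ∀ i, X (σ.symm i) = X₁ i := fun i => by rw [eX, σ.apply_symm_apply]
  have hYσ : ∀ i, Y (σ.symm i) = Y₁ i := fun i => by rw [eY, σ.apply_symm_apply]
  have hσ' : ∀ i < N, σ.symm i < N := fun i hi => (hσ _).1 (by rwa [σ.apply_symm_apply])
  refine ⟨X, Y, _, ⟨hmonoY, hmonoZ, fun i hi => ?_, fun i hi => ?_, ?_, fun i hi => ?_,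
    ⟨σ.symm n, hσ' n (by omega), by rw [hXσ, hx0], by rw [hYσ, hy0]⟩,
    ⟨σ.symm (n + 1), hσ' _ (by omega), by rw [hXσ, hx1], by rw [hYσ, hy1]⟩⟩,
    by rw [f4.reals 0 rfl, f3X], by rw [f4.reals 1 rfl, f3Y], rfl,
    by rw [f4.int 1 rfl, f3.int 1 rfl, g1],
    by rw [f4.int 2 rfl, f3.int 2 rfl, f2.int 2 rfl, e2]⟩
  · refine ⟨τ.symm i, (hτ _).1 (by rwa [τ.apply_symm_apply]), ?_⟩
    rw [hZ, Function.comp, τ.apply_symm_apply, h3 i hi]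
  · have hx := A.hx
    have hy := A.hy
    rw [eX, eY]
    rcases hall (σ i) ((hσ i).2 hi) with ⟨h, e, e'⟩ | ⟨e, e'⟩ | ⟨e, e'⟩
    · rw [e, e']
      exact hp ⟨σ i, h⟩
    · rw [e, e']
      exact ⟨⟨le_rfl, hx.le⟩, le_rfl, hy.le⟩
    · rw [e, e']
      exact ⟨⟨hx.le, le_rfl⟩, hy.le, le_rfl⟩
  · rintro _ ⟨i, rfl⟩
    refine ⟨σ.symm i, hσ' i (by omega), ?_⟩
    rw [hXσ, hYσ, (hpts i i.2).1, (hpts i i.2).2]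
  · rw [eX, eY]
    rcases hall (σ i) ((hσ i).2 hi) with ⟨h, e, e'⟩ | h
    · exact .inl ⟨⟨σ i, h⟩, by rw [e, e']⟩
    · exact .inr h

/-- The memory holds a complete data structure for the point set `P`. -/
structure Complete (A : Rect) (P : Set (ℝ × ℝ)) (S N M H : ℕ) (m : Memory) : Prop where
  size0 : m.ints 2 0 = N
  size1 : m.ints 2 1 = M
  size2 : m.ints 2 2 = H
  le : ∀ i, m.ints 0 i < S
  grid : ∃ X, Grid A P N X (m.reals 1) (m.reals 2)
  best : ∀ q ∈ A.region, ∃ R : Rect, R.IsLargestEmptyAt A P q ∧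
    m.box (m.ints 0 (cellIdx M H (M + gridPos (m.reals 2) N q.1) (H - 1)
      (gridPos (m.reals 1) N q.2))) = ⟨R.x₀, R.x₁, R.y₀, R.y₁⟩

theorem preprocess_runs {n S M : ℕ} {A : Rect} {p : Fin n → ℝ × ℝ} (hp : ∀ i, p i ∈ A.region)
    (z : Sizes S (n + 2) M (Nat.log 2 M + 1)) :
    Runs S preprocess (qmerInput A p) (3000 * ((n + 2) * (n + 2) * (Nat.log 2 M + 1)))
      (fun s => Complete A (Set.range p) S (n + 2) M (Nat.log 2 M + 1) s.mem) := by
  have hMS := z.four_mul_lt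
  have hHS := z.H_lt
  have hM := z.hM
  set N := n + 2 with hN
  set H := Nat.log 2 M + 1 with hH
  have hN2 : 2 ≤ N := z.hN
  have hH2 : 2 ≤ H := z.two_le_H
  refine (Runs.seq' (buildGrid_runs hp z) (T' := 20 * H + 10 +
    (N * (2 * (N * (230 * H + 350)) + 38) + 6 + (2 * M * H * M * 150 + 20 + 9)))
    ?_).mono ?_ fun _ _ h => h
  swap
  -- Since `N` and `H` are at least 2, all lower-order terms are absorbed by `N * N * H`; the table
  -- has 8 times that many cells.
  · have h1 : N * N * 2 ≤ N * N * H := Nat.mul_le_mul_left _ hH2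
    have h2 : N * 2 ≤ N * N := Nat.mul_le_mul_left _ hN2
    have h3 : 4 * H ≤ N * N * H := Nat.mul_le_mul_right _ (Nat.mul_le_mul hN2 hN2)
    have e1 : 2 * M * H * M = 8 * (N * N * H) := by rw [hM]; ring
    have e2 : N * (2 * (N * (230 * H + 350)) + 38) = 460 * (N * N * H) + 700 * (N * N) + 38 * N := by
      ring
    have e3 : N * (N * 50 + 14) = 50 * (N * N) + 14 * N := by ring
    rw [e1, e2, e3]
    omega
  rintro s1 f1 ⟨X, Y, Z, g, hX, hY, hZ, e1, e2⟩
  refine Runs.seq' (powers_runs z e2) ?_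
  rintro s2 f2 ⟨e3, hpw⟩
  have r2 : Ready A N M H X Y Z s2 := by
    refine ⟨by rw [f2.int 1 rfl, e1], by rw [f2.int 2 rfl, e2], e3, ?_, ?_, ?_,
      by rw [f2.reals 0 rfl, hX], by rw [f2.reals 1 rfl, hY], by rw [f2.reals 2 rfl, hZ], hpw⟩
    · rw [f2.real 0 rfl, f1.real 0 rfl]; simp [qmerInput]
    · rw [f2.real 1 rfl, f1.real 1 rfl]; simp [qmerInput]
    · rw [f2.real 2 rfl, f1.real 2 rfl]; simp [qmerInput]
  have hT0 : ∀ i, s2.mem.ints 0 i = 0 := fun i => by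
    rw [f2.ints 0 rfl, f1.ints 0 rfl]; simp [qmerInput]
  have t2 : BoxTable (Set.range p) N M H X Y Z s2.mem 0 := by
    refine ⟨fun i => (hT0 i).le, ?_, fun id h1 h2 => by omega, fun i hi => absurd (hT0 i) hi⟩
    rw [f2.reals 8 rfl, f1.reals 8 rfl]
    simp [qmerInput]
  refine Runs.seq' (generate_runs z g r2 t2
    (by rw [f2.int 4 rfl, f1.int 4 rfl]; simp [qmerInput])) ?_
  rintro s3 f3 ⟨cnt, hcnt, t3, hrec⟩
  have r3 := r2.frame f3 rfl
  refine Runs.seq' (complete_runs (ar := s3.mem.reals 8) (T := s3.mem.ints 0) z r3.int2 r3.int3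
    r3.pow hcnt rfl rfl t3.le t3.sound) ?_
  rintro s4 f4 ⟨hle, hsound, hmono, hpull⟩
  have r4 := r3.frame f4 rfl
  have h8 : s4.mem.reals 8 = s3.mem.reals 8 := f4.reals 8 rfl
  have t4 : BoxTable (Set.range p) N M H X Y Z s4.mem cnt :=
    t3.congr hle hsound (f4.reals 4 rfl) (f4.reals 5 rfl) (f4.reals 6 rfl) (f4.reals 7 rfl) h8
  have hval : s4.mem.value = fun k => s3.mem.reals 8 (s4.mem.ints 0 k) := by
    funext k
    rw [Memory.value, h8]
  have hst : Runs S storeSizes s4 9 (fun s => s.mem.ints 2 0 = N ∧ s.mem.ints 2 1 = M ∧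
      s.mem.ints 2 2 = H) := by
    refine (Runs.of_wp ?_).mono (by decide) fun _ _ h => h
    simp [storeSizes, r4.int1, r4.int2, r4.int3]
    omega
  refine hst.mono le_rfl ?_
  rintro s5 f5 ⟨q0, q1, q2⟩
  have c0 : s5.mem.ints 0 = s4.mem.ints 0 := f5.ints 0 rfl
  have cr : s5.mem.reals = s4.mem.reals := funext fun a => f5.reals a rfl
  have cb : s5.mem.box = s4.mem.box := by
    funext id
    simp only [Memory.box, cr]
  refine ⟨q0, q1, q2, fun i => ?_, ⟨X, ?_⟩, ?_⟩
  · rw [c0]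
    exact (hle i).trans_lt hcnt
  · rw [cr, r4.reals1, r4.reals2]
    exact g
  · rw [cr, r4.reals1, r4.reals2, c0, cb]
    intro q hq
    refine t4.exists_isLargestEmptyAt z g (fun j hj ya hya k hk hv =>
      (hrec j hj ya hya k hk hv).mono fun i => ?_) ?_ hq
    · rw [hval]
      exact hmono i
    · rw [hval]
      exact hpull

/-! ## The query program -/

/-- The query program: locate the query point and look up its cell in the table. -/
def query : Cmd :=
  .seq (.seq (.setInt 1 (.load 2 (.const 0))) <|
    .seq (.setInt 2 (.load 2 (.const 1)))
    (.setInt 3 (.load 2 (.const 2)))) <|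
  .seq (locateTo 20 2 (.reg 0)) <|
  .seq (locateTo 21 1 (.reg 1)) <|
  .seq (.setInt 4 (.load 0 (cellExpr (.add (.reg 2) (.reg 20)) (.sub (.reg 3) (.const 1))
    (.reg 21)))) <|
  .seq (.setReal 0 (.load 4 (.reg 4))) <|
  .seq (.setReal 1 (.load 5 (.reg 4))) <|
  .seq (.setReal 2 (.load 6 (.reg 4)))
  (.setReal 3 (.load 7 (.reg 4)))

theorem query_runs {A : Rect} {P : Set (ℝ × ℝ)} {S N M H : ℕ} {m : Memory} (z : Sizes S N M H)
    (hm : Complete A P S N M H m) {q : ℝ × ℝ} (hq : q ∈ A.region) :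
    Runs S query (qmerQuery m q) (38 * H + 200) (fun s' => s'.mem = m ∧
      ∃ R : Rect, R.IsLargestEmptyAt A P q ∧ Reports s' R) := by
  have hMS := z.four_mul_lt
  have hHS := z.H_lt
  have hM := z.hM
  have hN := z.hN
  have hH := z.hH
  obtain ⟨X, g⟩ := hm.grid
  obtain ⟨R, hR, hbox⟩ := hm.best q hq
  have hle := hm.le
  obtain ⟨c, hc, hcx, hcy⟩ := g.corner₁
  have htx : ∃ i < N, q.1 ≤ m.reals 2 i := by
    obtain ⟨c', hc', h⟩ := g.memZ c hc
    exact ⟨c', hc', by rw [h, hcx]; exact hq.1.2⟩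
  have hty : ∃ i < N, q.2 ≤ m.reals 1 i := ⟨c, hc, by rw [hcy]; exact hq.2.2⟩
  -- The query program stores to no array, so the frame rule alone gives the unchanged memory.
  refine (Runs.seq' (T := 9) (T' := 38 * H + 150) (P := fun s => s.intReg 1 = N ∧ s.intReg 2 = M ∧
    s.intReg 3 = H) ((Runs.of_wp ?_).mono (by decide) fun _ _ h => h) ?_).mono (by omega)
    fun s' f h => ⟨f.mem_eq (fun _ => rfl) (fun _ => rfl), R, hR, h⟩
  · simp [qmerQuery, hm.size0, hm.size1, hm.size2]
    omega
  rintro s1 f1 ⟨e1, e2, e3⟩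
  have m1 : s1.mem = m := f1.mem_eq (fun _ => rfl) (fun _ => rfl)
  have x1 : s1.realReg 0 = q.1 := by rw [f1.real 0 rfl]; simp [qmerQuery]
  have y1 : s1.realReg 1 = q.2 := by rw [f1.real 1 rfl]; simp [qmerQuery]
  refine (Runs.seq' (locateTo_runs (e := .reg 0) (x := 20) z e1 (by rw [m1]) g.monoZ trivial
    (by simpa [x1] using htx)) (T' := 19 * H + 100) ?_).mono
    (by simp only [RealExpr.cost]; omega) fun _ _ h => h
  intro s2 f2 e20
  simp only [RealExpr.eval, x1] at e20
  have m2 : s2.mem = m := (f2.mem_eq (fun _ => rfl) (fun _ => rfl)).trans m1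
  have y2 : s2.realReg 1 = q.2 := by rw [f2.real 1 rfl, y1]
  refine (Runs.seq' (locateTo_runs (e := .reg 1) (x := 21) z (by rw [f2.int 1 rfl, e1])
    (by rw [m2]) g.monoY trivial (by simpa [y2] using hty)) (T' := 50) ?_).mono
    (by simp only [RealExpr.cost]; omega) fun _ _ h => h
  intro s3 f3 e21
  simp only [RealExpr.eval, y2] at e21
  have m3 : s3.mem = m := (f3.mem_eq (fun _ => rfl) (fun _ => rfl)).trans m2
  have g2 : s3.intReg 2 = M := by rw [f3.int 2 rfl, f2.int 2 rfl, e2]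
  have g3 : s3.intReg 3 = H := by rw [f3.int 3 rfl, f2.int 3 rfl, e3]
  have g20 : s3.intReg 20 = gridPos (m.reals 2) N q.1 := by rw [f3.int 20 rfl, e20]
  have hpx := gridPos_lt_two_mul htx
  have hpy := gridPos_lt_two_mul hty
  rw [← hM] at hpx hpy
  have hidx := cellIdx_lt (V := 2 * M) (v := M + gridPos (m.reals 2) N q.1) (j := H - 1) (by omega)
    (Nat.sub_lt hH one_pos) hpy
  have hid := hle (cellIdx M H (M + gridPos (m.reals 2) N q.1) (H - 1) (gridPos (m.reals 1) N q.2))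
  have hidx' := hidx.trans z.lt_S
  unfold cellIdx at hbox hid hidx'
  refine (Runs.of_wp ?_).mono (by decide) fun _ _ h => h
  simp only [Memory.box, Box.mk.injEq] at hbox
  simp [cellExpr, m3, g2, g3, g20, e21, Reports, hid, hidx', hbox]

end RealRAM

/-! ### Sizes and constants in terms of n -/

open RealRAM in
theorem exists_sizes (n : ℕ) : ∃ M, Sizes (100000 * (n ^ 2 * Nat.log 2 n + 1)) (n + 2) M
    (Nat.log 2 M + 1) ∧ (n + 2) * (n + 2) * (Nat.log 2 M + 1) ≤ 27 * (n ^ 2 * Nat.log 2 n + 1) ∧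
    Nat.log 2 M + 1 ≤ Nat.log 2 n + 3 := by
  have hlog : Nat.log 2 (2 * (n + 2)) + 1 ≤ Nat.log 2 n + 3 := by
    rcases Nat.lt_or_ge n 2 with h | h
    · have h8 : Nat.log 2 (2 * (n + 2)) < 3 := Nat.log_lt_of_lt_pow (by omega) (by omega)
      omega
    · have h1 : Nat.log 2 (2 * (n + 2)) ≤ Nat.log 2 (n * 2 * 2) := Nat.log_mono_right (by omega)
      rw [Nat.log_mul_base (by norm_num) (by omega), Nat.log_mul_base (by norm_num) (by omega)] at h1
      omega
  have hW : (n + 2) * (n + 2) * (Nat.log 2 (2 * (n + 2)) + 1) ≤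
      27 * (n ^ 2 * Nat.log 2 n + 1) := by
    refine (Nat.mul_le_mul_left _ hlog).trans ?_
    rcases Nat.lt_or_ge n 2 with h | h
    -- Here the logarithm of `n` vanishes, and the constant 27 is what `n = 1` requires: 3 · 3 · 3.
    · interval_cases n <;> simp
    · have h1 : 1 ≤ Nat.log 2 n := Nat.log_pos (by norm_num) h
      calc (n + 2) * (n + 2) * (Nat.log 2 n + 3) ≤ (2 * n) * (2 * n) * (4 * Nat.log 2 n) := by
            gcongr <;> omega
        _ = 16 * (n ^ 2 * Nat.log 2 n) := by ring
        _ ≤ _ := by omega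
  refine ⟨2 * (n + 2), ⟨by omega, rfl, by omega, ?_, ?_, ?_⟩, hW, hlog⟩
  · exact Nat.pow_log_le_self 2 (by omega)
  · exact Nat.lt_pow_succ_log_self (by norm_num) _
  · have : 2 * (2 * (n + 2)) * (Nat.log 2 (2 * (n + 2)) + 1) * (2 * (n + 2)) =
        8 * ((n + 2) * (n + 2) * (Nat.log 2 (2 * (n + 2)) + 1)) := by ring
    omega

/-- There are a preprocessing program, a query program and a constant `K`, independent of the
input, such that for every `n` and all `n` points in a rectangle `A`: preprocessing takes at most
`K (n² log n + 1)` steps and uses only memory cells with index at most that bound; afterwards, for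
every query point `q` in `A`, a query takes at most `K (log n + 1)` steps, leaves the data structure
intact and reports a largest-area empty rectangle containing `q`. -/
theorem mainTheorem6 :
    ∃ (preprocessing query : RealRAM.Cmd) (K : ℕ),
      ∀ (n : ℕ) (A : Rect) (p : Fin n → ℝ × ℝ),
        Function.Injective p → (∀ i, p i ∈ A.region) →
        ∃ (s : RealRAM.State) (t : ℕ),
          RealRAM.Exec (K * (n ^ 2 * Nat.log 2 n + 1)) preprocessing (qmerInput A p) s t ∧
          t ≤ K * (n ^ 2 * Nat.log 2 n + 1) ∧
          ∀ q ∈ A.region,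
            ∃ (s' : RealRAM.State) (t' : ℕ),
              RealRAM.Exec (K * (n ^ 2 * Nat.log 2 n + 1)) query (qmerQuery s.mem q) s' t' ∧
              t' ≤ K * (Nat.log 2 n + 1) ∧
              s'.mem = s.mem ∧
              ∃ R : Rect, R.IsLargestEmptyAt A (Set.range p) q ∧ Reports s' R := by
  -- The constant exceeds 3000 · 27 for preprocessing and 38 · 3 + 200 for a query, and leaves room
  -- for the table with at most 8 · 27 times the basic quantity.
  refine ⟨RealRAM.preprocess, RealRAM.query, 100000, fun n A p _ hp => ?_⟩
  obtain ⟨M, z, hW, hH⟩ := exists_sizes n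
  obtain ⟨s, t, hs, ht, hc⟩ := RealRAM.preprocess_runs hp z
  refine ⟨s, t, hs, by omega, fun q hq => ?_⟩
  obtain ⟨s', t', hs', ht', hmem, R, hR, hrep⟩ := RealRAM.query_runs z hc hq
  exact ⟨s', t', hs', by omega, hmem, R, hR, hrep⟩
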